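/- Let $I\subseteq\mathbb R$ be an open interval and let $H,D:I\to\mathbb R$ be smooth with $D\neq0$ on $I$. The corresponding Gödel-type spacetime is $\bar M=\mathbb R\times I\times\mathbb R\times\mathbb R$, with coordinates $(x_1,x_2,x_3,x_4)=(t,r,\phi,z)$ and metric $$g=(dt+H(r)\,d\phi)^2-dr^2-D(r)^2\,d\phi^2-dz^2 .$$ Let $F:M\to\bar M$ be a smooth immersion of a connected smooth $3$-manifold with nondegenerate induced metric and a smooth unit normal field $\xi$, $g(\xi,\xi)=\varepsilon\in\{1,-1\}$. Its second fundamental form $h$ is defined by $\nabla_XY=\nabla^M_XY+h(X,Y)\xi$, and its mean curvature is the trace of $h$ with respect to the induced metric. Assume that $M$ is parallel ($\nabla^Mh=0$) and proper ($h\not\equiv0$). We say that $M$ *corresponds to* one of the cases below if around every point of $M$ there are local coordinates $(u_1,u_2,u_3)$ in which, up to an isometry between open subsets of $\bar M$, $F$ is given by the stated expression (conditions on $H$, $D$ are understood along the hypersurface, i.e. for the values of $r$ attained on it): 1. $F=\left(u_1-\frac{H(c)}{D(c)}u_2,\;c,\;\frac1{D(c)}u_2,\;u_3\right)$ with a constant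 $c\in I$; $M$ is timelike. 2. $\frac{H'}{2D}$ is constant and $$F=\left(u_1+\int_0^{u_2}\frac HD\cos\theta\,ds,\;\rho(u_2),\;-\int_0^{u_2}\frac{\cos\theta}{D}\,ds,\;u_3\right),\qquad \rho(s)=r_0+\int_0^{s}\sin\theta ,$$ where $r_0\in\mathbb R$, $\theta$ is a smooth function on an open interval containing $0$ with $\cos\theta\ne0$, $H$ and $D$ are evaluated at $r=\rho(s)\in I$, and $\partial_{u_2}\big(\ln|D\cos\theta|\big)=-\lambda\tan\theta$ for a real constant $\lambda$; $\sin\theta$ does not vanish identically on the coordinate domain (otherwise $r$ is constant there, as in case 1); $M$ is timelike. 3. $\left(\frac{H'}{D}\right)^2-\frac{D''}{D}\neq0$, $\ \left|\frac{(H'/D)'}{(H'/D)^2-D''/D}\right|<1$, $\ D'\neq H'$, $\ 4D^2\lambda^2+(D')^2\ge(H')^2$ for a real constant $\lambda$, and either $$F=\left(\Big(\sinh\theta-\frac HD\cosh\theta\Big)u_1e^{ku_1}u_3,\;u_1,\;\frac{\cosh\theta}{D}u_1e^{ku_1}u_3,\;u_2\right)$$ and $M$ is spacelike, or the same expression with $\sinh\theta$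 and $\cosh\theta$ interchanged and $M$ is timelike; here $k\in\mathbb R$ and $\theta=\frac12\ln\frac{2D\lambda\pm\sqrt{4D^2\lambda^2+(D')^2-(H')^2}}{D'-H'}$ (with one of the two signs and positive argument of $\ln$), and $H,D,\theta$ are evaluated at $r=u_1$. 4. $H$ is constant and, for a real constant $c\neq0$, either $F=(c\cosh u_1-Hu_3,\;u_2,\;u_3,\;c\sinh u_1)$ and $M$ is spacelike, or $F=(c\sinh u_1-Hu_3,\;u_2,\;u_3,\;c\cosh u_1)$ and $M$ is timelike. **Corollary (CMC parallel hypersurfaces).** Let $M$ be a proper parallel hypersurface corresponding to one of the cases 1–4. Then $M$ has nonzero constant mean curvature if and only if one of the following occurs: (a) $M$ corresponds to case 1 with $D'$ equal to a nonzero constant along $M$, i.e. $D'(c)\neq0$; (b) $M$ corresponds to case 2 with $\lambda\neq0$; (c) $M$ corresponds to case 4. -/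

import Mathlib

open Set Matrix
open scoped Manifold ContDiff

noncomputable section

namespace GodelType

/-! ### Local pseudo-Riemannian geometry in coordinates -/

/-- The partial derivative `∂ᵢ f` of a map on `ℝⁿ`. -/
def pd {n : ℕ} {E : Type*} [NormedAddCommGroup E] [NormedSpace ℝ E] (i : Fin n)
    (f : (Fin n → ℝ) → E) (x : Fin n → ℝ) : E :=
  fderiv ℝ f x (Pi.single i 1)

/-- The Christoffel symbols `Γᵏᵢⱼ` of the Levi-Civita connection of the metric with matrix `G`:
`Γᵏᵢⱼ = ½ ∑ₗ gᵏˡ (∂ᵢ gⱼₗ + ∂ⱼ gᵢₗ - ∂ₗ gᵢⱼ)`. -/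
def christoffel {n : ℕ} (G : (Fin n → ℝ) → Matrix (Fin n) (Fin n) ℝ) (x : Fin n → ℝ)
    (k i j : Fin n) : ℝ :=
  (1 / 2) * ∑ l, (G x)⁻¹ k l *
    (pd i (fun y => G y j l) x + pd j (fun y => G y i l) x - pd l (fun y => G y i j) x)

/-! ### Gödel-type spacetimes -/

/-- The data of a Gödel-type metric: smooth functions `H`, `D` of the radial variable on an open
interval `I`, with `D` nowhere zero. -/
structure IsGodelType (I : Set ℝ) (H D : ℝ → ℝ) : Prop where
  isOpen : IsOpen I
  ordConnected : I.OrdConnected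
  smooth_H : ContDiffOn ℝ ∞ H I
  smooth_D : ContDiffOn ℝ ∞ D I
  D_ne_zero : ∀ r ∈ I, D r ≠ 0

/-- The underlying open set of the spacetime, in the coordinates
`(x 0, x 1, x 2, x 3) = (t, r, φ, z)`. -/
def spacetime (I : Set ℝ) : Set (Fin 4 → ℝ) := {x | x 1 ∈ I}

/-- The matrix of `g = (dt + H(r) dφ)² - dr² - D(r)² dφ² - dz²`. -/
def metric (H D : ℝ → ℝ) (x : Fin 4 → ℝ) : Matrix (Fin 4) (Fin 4) ℝ :=
  !![1, 0, H (x 1), 0;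
     0, -1, 0, 0;
     H (x 1), 0, H (x 1) ^ 2 - D (x 1) ^ 2, 0;
     0, 0, 0, -1]

/-- The scalar product `gₓ(v, w)`. -/
def ip (H D : ℝ → ℝ) (x v w : Fin 4 → ℝ) : ℝ := v ⬝ᵥ (metric H D x *ᵥ w)

/-- `Φ` is an isometry from the open subset `V` of the spacetime onto its image in the
spacetime. -/
structure IsIsometryOn (I : Set ℝ) (H D : ℝ → ℝ) (V : Set (Fin 4 → ℝ))
    (Φ : (Fin 4 → ℝ) → (Fin 4 → ℝ)) : Prop where
  isOpen : IsOpen V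
  subset : V ⊆ spacetime I
  mapsTo : MapsTo Φ V (spacetime I)
  injOn : InjOn Φ V
  smooth : ContDiffOn ℝ ∞ Φ V
  isometry : ∀ x ∈ V, ∀ v w : Fin 4 → ℝ,
    ip H D (Φ x) (fderiv ℝ Φ x v) (fderiv ℝ Φ x w) = ip H D x v w

/-! ### Extrinsic geometry of a parametrized hypersurface `X` with unit normal `ν` -/

/-- The induced metric (first fundamental form). -/
def inducedMetric (H D : ℝ → ℝ) (X : (Fin 3 → ℝ) → (Fin 4 → ℝ)) (u : Fin 3 → ℝ) :
    Matrix (Fin 3) (Fin 3) ℝ :=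
  Matrix.of fun i j => ip H D (X u) (pd i X u) (pd j X u)

/-- The ambient covariant derivative `∇_{∂ᵢ} ∂ⱼ` of the coordinate fields along `X`. -/
def ambientCov (H D : ℝ → ℝ) (X : (Fin 3 → ℝ) → (Fin 4 → ℝ)) (u : Fin 3 → ℝ)
    (i j : Fin 3) : Fin 4 → ℝ := fun k =>
  pd i (fun y => pd j X y k) u +
    ∑ a, ∑ b, christoffel (metric H D) (X u) k a b * pd i X u a * pd j X u b

/-- The second fundamental form, i.e. the coefficients `hᵢⱼ` in the formula of Gauss
`∇_{∂ᵢ} ∂ⱼ = ∇ᴹ_{∂ᵢ} ∂ⱼ + hᵢⱼ ν`; since `g(ν, ν) = ε = ±1`, `hᵢⱼ = ε g(∇_{∂ᵢ} ∂ⱼ, ν)`. -/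
def secondFF (H D : ℝ → ℝ) (ε : ℝ) (X ν : (Fin 3 → ℝ) → (Fin 4 → ℝ)) (u : Fin 3 → ℝ)
    (i j : Fin 3) : ℝ :=
  ε * ip H D (X u) (ambientCov H D X u i j) (ν u)

/-- The components `(∇ᴹ h)(∂ᵢ, ∂ⱼ, ∂ₖ)`, with `∇ᴹ` the Levi-Civita connection of the induced
metric. -/
def covSecondFF (H D : ℝ → ℝ) (ε : ℝ) (X ν : (Fin 3 → ℝ) → (Fin 4 → ℝ)) (u : Fin 3 → ℝ)
    (i j k : Fin 3) : ℝ :=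
  pd i (fun y => secondFF H D ε X ν y j k) u
    - ∑ l, christoffel (inducedMetric H D X) u l i j * secondFF H D ε X ν u l k
    - ∑ l, christoffel (inducedMetric H D X) u l i k * secondFF H D ε X ν u j l

/-- The mean curvature: the trace of the second fundamental form with respect to the induced
metric. -/
def meanCurv (H D : ℝ → ℝ) (ε : ℝ) (X ν : (Fin 3 → ℝ) → (Fin 4 → ℝ)) (u : Fin 3 → ℝ) : ℝ :=
  ∑ i, ∑ j, (inducedMetric H D X u)⁻¹ i j * secondFF H D ε X ν u i j

/-- All tangent vectors are spacelike (negative, in signature `(+,-,-,-)`). -/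
def Spacelike (H D : ℝ → ℝ) (U : Set (Fin 3 → ℝ)) (X : (Fin 3 → ℝ) → (Fin 4 → ℝ)) : Prop :=
  ∀ u ∈ U, ∀ v : Fin 3 → ℝ, v ≠ 0 → v ⬝ᵥ (inducedMetric H D X u *ᵥ v) < 0

/-- Every (nondegenerate) tangent space contains a timelike (positive) vector, i.e. the induced
metric is Lorentzian. -/
def Timelike (H D : ℝ → ℝ) (U : Set (Fin 3 → ℝ)) (X : (Fin 3 → ℝ) → (Fin 4 → ℝ)) : Prop :=
  ∀ u ∈ U, (inducedMetric H D X u).det ≠ 0 ∧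
    ∃ v : Fin 3 → ℝ, 0 < v ⬝ᵥ (inducedMetric H D X u *ᵥ v)

/-! ### Hypersurfaces

A hypersurface is a smooth 3-manifold `M` with a smooth map `F` into the spacetime and a smooth
unit normal field `ξ` along `F`. Tensors on `M` are described by their components in the charts
`e` of the maximal atlas, where `F` reads `F ∘ e.symm` and `ξ` reads `ξ ∘ e.symm`. -/

section Manifold

variable {M : Type*} [TopologicalSpace M] [ChartedSpace (Fin 3 → ℝ) M]

/-- `F : M → (spacetime, g)` is an immersed pseudo-Riemannian hypersurface (nondegenerate induced
metric) with unit normal vector field `ξ`, `g(ξ, ξ) = ε ∈ {1, -1}`. -/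
structure IsHypersurface (I : Set ℝ) (H D : ℝ → ℝ) (ε : ℝ) (F ξ : M → (Fin 4 → ℝ)) : Prop where
  smooth : ContMDiff 𝓘(ℝ, Fin 3 → ℝ) 𝓘(ℝ, Fin 4 → ℝ) ∞ F
  smooth_normal : ContMDiff 𝓘(ℝ, Fin 3 → ℝ) 𝓘(ℝ, Fin 4 → ℝ) ∞ ξ
  mem : ∀ p, F p ∈ spacetime I
  sign : ε = 1 ∨ ε = -1
  unit : ∀ p, ip H D (F p) (ξ p) (ξ p) = ε
  nondegenerate : ∀ e ∈ IsManifold.maximalAtlas 𝓘(ℝ, Fin 3 → ℝ) ∞ M, ∀ u ∈ e.target,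
    (inducedMetric H D (F ∘ e.symm) u).det ≠ 0
  normal : ∀ e ∈ IsManifold.maximalAtlas 𝓘(ℝ, Fin 3 → ℝ) ∞ M, ∀ u ∈ e.target, ∀ i : Fin 3,
    ip H D (F (e.symm u)) (pd i (F ∘ e.symm) u) (ξ (e.symm u)) = 0

/-- `∇ᴹ h = 0`. -/
def IsParallel (H D : ℝ → ℝ) (ε : ℝ) (F ξ : M → (Fin 4 → ℝ)) : Prop :=
  ∀ e ∈ IsManifold.maximalAtlas 𝓘(ℝ, Fin 3 → ℝ) ∞ M, ∀ u ∈ e.target, ∀ i j k : Fin 3,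
    covSecondFF H D ε (F ∘ e.symm) (ξ ∘ e.symm) u i j k = 0

/-- `h = 0`. -/
def IsTotallyGeodesic (H D : ℝ → ℝ) (ε : ℝ) (F ξ : M → (Fin 4 → ℝ)) : Prop :=
  ∀ e ∈ IsManifold.maximalAtlas 𝓘(ℝ, Fin 3 → ℝ) ∞ M, ∀ u ∈ e.target, ∀ i j : Fin 3,
    secondFF H D ε (F ∘ e.symm) (ξ ∘ e.symm) u i j = 0

/-- The mean curvature is a nonzero constant. -/
def IsNonzeroCMC (H D : ℝ → ℝ) (ε : ℝ) (F ξ : M → (Fin 4 → ℝ)) : Prop :=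
  ∃ κ : ℝ, κ ≠ 0 ∧
    ∀ e ∈ IsManifold.maximalAtlas 𝓘(ℝ, Fin 3 → ℝ) ∞ M, ∀ u ∈ e.target,
      meanCurv H D ε (F ∘ e.symm) (ξ ∘ e.symm) u = κ

/-- Around every point of `M` there are local coordinates on `M` such that, up to an isometry
`Φ` of the ambient space, the immersion has the form described by `P`. -/
def LocallyOfForm (I : Set ℝ) (H D : ℝ → ℝ)
    (P : Set (Fin 3 → ℝ) → ((Fin 3 → ℝ) → (Fin 4 → ℝ)) → Prop) (F : M → (Fin 4 → ℝ)) : Prop :=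
  ∀ p : M, ∃ e ∈ IsManifold.maximalAtlas 𝓘(ℝ, Fin 3 → ℝ) ∞ M, p ∈ e.source ∧
    ∃ (V : Set (Fin 4 → ℝ)) (Φ : (Fin 4 → ℝ) → (Fin 4 → ℝ)), IsIsometryOn I H D V Φ ∧
      (∀ u ∈ e.target, F (e.symm u) ∈ V) ∧ P e.target (Φ ∘ F ∘ e.symm)

end Manifold

/-! ### The four families

In the following, `X` is the immersion in the local coordinates `(u 0, u 1, u 2)`, which range
over `U`. Conditions on `H` and `D` are understood along the hypersurface. -/

/-- Family (1), with constant `c`. -/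
def Case1 (I : Set ℝ) (H D : ℝ → ℝ) (c : ℝ) (U : Set (Fin 3 → ℝ))
    (X : (Fin 3 → ℝ) → (Fin 4 → ℝ)) : Prop :=
  c ∈ I ∧ Timelike H D U X ∧
    ∀ u ∈ U, X u = ![u 0 - H c / D c * u 1, c, 1 / D c * u 1, u 2]

/-- The radial function `r₀ + ∫₀ˢ sin θ`. -/
def radial (θ : ℝ → ℝ) (r₀ s : ℝ) : ℝ := r₀ + ∫ x in (0 : ℝ)..s, Real.sin (θ x)

/-- Family (2), with constant `lam`. The function `θ` of `u 1` is defined on an open interval `J`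
around `0`; `sin θ` does not vanish identically (otherwise the radial coordinate is constant and
the hypersurface is a member of family (1)). `Real.log x` is `ln |x|`. -/
def Case2 (I : Set ℝ) (H D : ℝ → ℝ) (lam : ℝ) (U : Set (Fin 3 → ℝ))
    (X : (Fin 3 → ℝ) → (Fin 4 → ℝ)) : Prop :=
  ∃ (J : Set ℝ) (θ : ℝ → ℝ) (r₀ : ℝ),
    IsOpen J ∧ J.OrdConnected ∧ (0 : ℝ) ∈ J ∧ ContDiffOn ℝ ∞ θ J ∧
    (∀ s ∈ J, radial θ r₀ s ∈ I ∧ Real.cos (θ s) ≠ 0 ∧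
      deriv (fun t => Real.log (D (radial θ r₀ t) * Real.cos (θ t))) s
        = -lam * Real.tan (θ s)) ∧
    (∃ a : ℝ, ∀ s ∈ J, deriv H (radial θ r₀ s) / (2 * D (radial θ r₀ s)) = a) ∧
    (∀ u ∈ U, u 1 ∈ J) ∧ (∃ u ∈ U, Real.sin (θ (u 1)) ≠ 0) ∧ Timelike H D U X ∧
    ∀ u ∈ U, X u =
      ![u 0 + ∫ s in (0 : ℝ)..(u 1), H (radial θ r₀ s) / D (radial θ r₀ s) * Real.cos (θ s),
        radial θ r₀ (u 1),
        -∫ s in (0 : ℝ)..(u 1), Real.cos (θ s) / D (radial θ r₀ s),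
        u 2]

/-- The quotient `(2Dλ ± √(4D²λ² + D'² - H'²)) / (D' - H')`, with `σ = ±1` the chosen sign. -/
def case3Quot (H D : ℝ → ℝ) (lam σ r : ℝ) : ℝ :=
  (2 * D r * lam + σ * Real.sqrt (4 * D r ^ 2 * lam ^ 2 + deriv D r ^ 2 - deriv H r ^ 2)) /
    (deriv D r - deriv H r)

/-- The function `θ` of family (3). -/
def case3Theta (H D : ℝ → ℝ) (lam σ r : ℝ) : ℝ := 1 / 2 * Real.log (case3Quot H D lam σ r)

/-- Family (3). The first three and the sixth condition on `r = u 0` say that the quantities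
involved are defined. -/
def Case3 (I : Set ℝ) (H D : ℝ → ℝ) (U : Set (Fin 3 → ℝ))
    (X : (Fin 3 → ℝ) → (Fin 4 → ℝ)) : Prop :=
  ∃ lam k σ : ℝ, (σ = 1 ∨ σ = -1) ∧
    (∀ u ∈ U, u 0 ∈ I ∧ deriv D (u 0) ≠ deriv H (u 0) ∧
      (deriv H (u 0) / D (u 0)) ^ 2 - deriv (deriv D) (u 0) / D (u 0) ≠ 0 ∧
      |deriv (fun s => deriv H s / D s) (u 0) /
        ((deriv H (u 0) / D (u 0)) ^ 2 - deriv (deriv D) (u 0) / D (u 0))| < 1 ∧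
      deriv H (u 0) ^ 2 ≤ 4 * D (u 0) ^ 2 * lam ^ 2 + deriv D (u 0) ^ 2 ∧
      0 < case3Quot H D lam σ (u 0)) ∧
    ((Spacelike H D U X ∧ ∀ u ∈ U, X u =
        ![(Real.sinh (case3Theta H D lam σ (u 0))
              - H (u 0) / D (u 0) * Real.cosh (case3Theta H D lam σ (u 0)))
            * (u 0 * Real.exp (k * u 0) * u 2),
          u 0,
          Real.cosh (case3Theta H D lam σ (u 0)) / D (u 0) * (u 0 * Real.exp (k * u 0) * u 2),
          u 1]) ∨
     (Timelike H D U X ∧ ∀ u ∈ U, X u =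
        ![(Real.cosh (case3Theta H D lam σ (u 0))
              - H (u 0) / D (u 0) * Real.sinh (case3Theta H D lam σ (u 0)))
            * (u 0 * Real.exp (k * u 0) * u 2),
          u 0,
          Real.sinh (case3Theta H D lam σ (u 0)) / D (u 0) * (u 0 * Real.exp (k * u 0) * u 2),
          u 1]))

/-- Family (4), with constant `c ≠ 0`; `H` is constant along the hypersurface. -/
def Case4 (I : Set ℝ) (H D : ℝ → ℝ) (U : Set (Fin 3 → ℝ))
    (X : (Fin 3 → ℝ) → (Fin 4 → ℝ)) : Prop :=
  ∃ c : ℝ, c ≠ 0 ∧ (∀ u ∈ U, u 1 ∈ I) ∧ (∃ a : ℝ, ∀ u ∈ U, H (u 1) = a) ∧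
    ((Spacelike H D U X ∧ ∀ u ∈ U, X u =
        ![c * Real.cosh (u 0) - H (u 1) * u 2, u 1, u 2, c * Real.sinh (u 0)]) ∨
     (Timelike H D U X ∧ ∀ u ∈ U, X u =
        ![c * Real.sinh (u 0) - H (u 1) * u 2, u 1, u 2, c * Real.cosh (u 0)]))

end GodelType

end

namespace GodelType

/-! ### Christoffel symbols and the ambient metric -/

/-! Both `h` and the induced metric are parallel, so the trace of `h` has zero derivative. As `M` is
connected, the mean curvature is a single constant `κ`, the same in all charts
(`pd_meanCurv_eq_zero`, `exists_meanCurv_eq`). What remains is to decide when `κ ≠ 0`, and for this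
any one local form of `F` may be used, provided the mean curvature depends neither on the parameters
nor on ambient isometries. Both invariances (`meanCurv_reparam`, `isometry_apply`) rest on
`secondFF_eq_firstVar`: up to the factor `-ε/2`, `h` is the variation of the induced metric along
the normal.

In each family the unit normal is found from its linear equations up to a scalar factor, which is
nonzero because the normal has length `ε ≠ 0`. Only the vanishing of `κ` matters, so the factor is
never computed. Family 1: `κ D(c)` is a nonzero multiple of `D'(c)`. Family 2: where `sin θ ≠ 0`,
the equation for `ln |D cos θ|` turns `κ` into a nonzero multiple of `λ`. Family 4: `κ = 0` would
force the normal to vanish. Family 3: the hypersurface is ruled, and along a ruling line with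
parameter `w` the mean curvature is an odd algebraic function of `w`. Being constant, it vanishes
(`meanCurv_ruled`, `meanCurv_eq_zero_of_ruled`). This family therefore contributes nothing, and the
specific `θ` plays no role. -/

lemma sum_christoffel_mul {n : ℕ} (G : (Fin n → ℝ) → Matrix (Fin n) (Fin n) ℝ) (x : Fin n → ℝ)
    (hs : (G x).IsSymm) (hu : (G x).det ≠ 0) (i j m : Fin n) :
    ∑ l, christoffel G x l i j * G x l m =
      1 / 2 * (pd i (fun y => G y j m) x + pd j (fun y => G y i m) x
        - pd m (fun y => G y i j) x) := by
  set T : Fin n → ℝ := fun l =>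
    pd i (fun y => G y j l) x + pd j (fun y => G y i l) x - pd l (fun y => G y i j) x with hT
  have h1 : ∀ l, christoffel G x l i j = 1 / 2 * ((G x)⁻¹ *ᵥ T) l := fun l => rfl
  have h2 : ∑ l, christoffel G x l i j * G x l m = 1 / 2 * (G x *ᵥ ((G x)⁻¹ *ᵥ T)) m := by
    simp only [h1]
    rw [Matrix.mulVec, dotProduct, Finset.mul_sum]
    refine Finset.sum_congr rfl fun l _ => ?_
    rw [← hs.apply m l]
    ring
  rw [h2, Matrix.mulVec_mulVec, Matrix.mul_nonsing_inv _ (isUnit_iff_ne_zero.2 hu),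
    Matrix.one_mulVec]

lemma ip_eq (H D : ℝ → ℝ) (x v w : Fin 4 → ℝ) :
    ip H D x v w = v 0 * w 0 + H (x 1) * (v 0 * w 2 + v 2 * w 0)
      + (H (x 1) ^ 2 - D (x 1) ^ 2) * (v 2 * w 2) - v 1 * w 1 - v 3 * w 3 := by
  simp [ip, metric, Matrix.mulVec, dotProduct, Fin.sum_univ_four]
  ring

lemma ip_comm (H D : ℝ → ℝ) (x v w : Fin 4 → ℝ) : ip H D x v w = ip H D x w v := by
  simp only [ip_eq]; ring

lemma ip_add_left (H D : ℝ → ℝ) (x v v' w : Fin 4 → ℝ) :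
    ip H D x (v + v') w = ip H D x v w + ip H D x v' w := by
  simp only [ip_eq, Pi.add_apply]; ring

lemma ip_sum_smul_left {ι : Type*} (s : Finset ι) (H D : ℝ → ℝ) (x w : Fin 4 → ℝ) (c : ι → ℝ)
    (v : ι → Fin 4 → ℝ) :
    ip H D x (∑ k ∈ s, c k • v k) w = ∑ k ∈ s, c k * ip H D x (v k) w := by
  simp only [ip, sum_dotProduct, smul_dotProduct, smul_eq_mul]

lemma ip_sum_smul_right {ι : Type*} (s : Finset ι) (H D : ℝ → ℝ) (x w : Fin 4 → ℝ) (c : ι → ℝ)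
    (v : ι → Fin 4 → ℝ) :
    ip H D x w (∑ k ∈ s, c k • v k) = ∑ k ∈ s, c k * ip H D x w (v k) := by
  simp only [ip_comm H D x w, ip_sum_smul_left]

/-- The radial derivative of the scalar product `g(v, w)` of constant vectors. -/
noncomputable def radialDerivIp (H D : ℝ → ℝ) (x v w : Fin 4 → ℝ) : ℝ :=
  deriv H (x 1) * (v 0 * w 2 + v 2 * w 0)
    + (2 * H (x 1) * deriv H (x 1) - 2 * D (x 1) * deriv D (x 1)) * (v 2 * w 2)

lemma radialDerivIp_comm (H D : ℝ → ℝ) (x v w : Fin 4 → ℝ) :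
    radialDerivIp H D x v w = radialDerivIp H D x w v := by
  simp only [radialDerivIp]; ring

lemma radialDerivIp_sum_smul_left {ι : Type*} (s : Finset ι) (H D : ℝ → ℝ) (x w : Fin 4 → ℝ)
    (c : ι → ℝ) (v : ι → Fin 4 → ℝ) :
    radialDerivIp H D x (∑ k ∈ s, c k • v k) w = ∑ k ∈ s, c k * radialDerivIp H D x (v k) w := by
  classical
  induction s using Finset.induction_on with
  | empty => simp [radialDerivIp]
  | insert a s ha ih =>
    rw [Finset.sum_insert ha, Finset.sum_insert ha, ← ih]
    simp only [radialDerivIp, Pi.add_apply, Pi.smul_apply, smul_eq_mul]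
    ring

lemma radialDerivIp_sum_smul_right {ι : Type*} (s : Finset ι) (H D : ℝ → ℝ) (x w : Fin 4 → ℝ)
    (c : ι → ℝ) (v : ι → Fin 4 → ℝ) :
    radialDerivIp H D x w (∑ k ∈ s, c k • v k) = ∑ k ∈ s, c k * radialDerivIp H D x w (v k) := by
  simp only [radialDerivIp_comm H D x w, radialDerivIp_sum_smul_left]

section Godel

variable {I : Set ℝ} {H D : ℝ → ℝ}

lemma IsGodelType.hasDerivAt_H (hg : IsGodelType I H D) {r : ℝ} (hr : r ∈ I) :
    HasDerivAt H (deriv H r) r :=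
  ((hg.smooth_H.contDiffAt (hg.isOpen.mem_nhds hr)).differentiableAt (by simp)).hasDerivAt

lemma IsGodelType.hasDerivAt_D (hg : IsGodelType I H D) {r : ℝ} (hr : r ∈ I) :
    HasDerivAt D (deriv D r) r :=
  ((hg.smooth_D.contDiffAt (hg.isOpen.mem_nhds hr)).differentiableAt (by simp)).hasDerivAt

lemma IsGodelType.hasDerivAt_ip (hg : IsGodelType I H D) {x v w : ℝ → Fin 4 → ℝ}
    {x' v' w' : Fin 4 → ℝ} {t : ℝ} (hx : HasDerivAt x x' t) (hv : HasDerivAt v v' t)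
    (hw : HasDerivAt w w' t) (hI : x t 1 ∈ I) :
    HasDerivAt (fun s => ip H D (x s) (v s) (w s))
      (x' 1 * radialDerivIp H D (x t) (v t) (w t) + ip H D (x t) v' (w t)
        + ip H D (x t) (v t) w') t := by
  simp only [ip_eq, radialDerivIp]
  rw [hasDerivAt_pi] at hx hv hw
  have hH : HasDerivAt (fun s => H (x s 1)) (deriv H (x t 1) * x' 1) t :=
    (hg.hasDerivAt_H hI).comp t (hx 1)
  have hD : HasDerivAt (fun s => D (x s 1)) (deriv D (x t 1) * x' 1) t :=
    (hg.hasDerivAt_D hI).comp t (hx 1)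
  refine HasDerivAt.congr_deriv (((((((hv 0).mul (hw 0)).add (hH.mul (((hv 0).mul (hw 2)).add ((hv 2).mul (hw 0))))).add
    (((hH.pow 2).sub (hD.pow 2)).mul ((hv 2).mul (hw 2)))).sub ((hv 1).mul (hw 1))).sub
    ((hv 3).mul (hw 3)))) ?_
  simp only [Pi.mul_apply, Pi.add_apply, Pi.sub_apply, Pi.pow_apply]
  push_cast
  ring

lemma metric_det (H D : ℝ → ℝ) (x : Fin 4 → ℝ) : (metric H D x).det = -D (x 1) ^ 2 := by
  simp [metric, Matrix.det_succ_row_zero, Fin.sum_univ_succ, Fin.succAbove]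
  ring

lemma metric_isSymm (H D : ℝ → ℝ) (x : Fin 4 → ℝ) : (metric H D x).IsSymm := by
  ext i j
  fin_cases i <;> fin_cases j <;> simp [metric]

lemma hasDerivAt_line {n : ℕ} {E : Type*} [NormedAddCommGroup E] [NormedSpace ℝ E]
    {f : (Fin n → ℝ) → E} {x : Fin n → ℝ} (hf : DifferentiableAt ℝ f x) (v : Fin n → ℝ) :
    HasDerivAt (fun t : ℝ => f (x + t • v)) (fderiv ℝ f x v) 0 := by
  have h1 : HasDerivAt (fun t : ℝ => x + t • v) v 0 := by
    simpa using ((hasDerivAt_id (0 : ℝ)).smul_const v).const_add x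
  have h2 : HasFDerivAt f (fderiv ℝ f x) (x + (0 : ℝ) • v) := by simpa using hf.hasFDerivAt
  exact h2.comp_hasDerivAt 0 h1

lemma IsGodelType.pd_metric (hg : IsGodelType I H D) {x : Fin 4 → ℝ} (hx : x 1 ∈ I)
    (c i j : Fin 4) :
    pd c (fun y => metric H D y i j) x =
      if c = 1 then radialDerivIp H D x (Pi.single i 1) (Pi.single j 1) else 0 := by
  have e1 : (fun y => metric H D y i j) =
      fun y => ip H D y (Pi.single i 1) (Pi.single j 1) := by
    funext y; simp [ip]
  have hd : DifferentiableAt ℝ (fun y => ip H D y (Pi.single i 1) (Pi.single j 1)) x := by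
    simp only [ip_eq]
    have h1 : DifferentiableAt ℝ (fun y : Fin 4 → ℝ => y 1) x := by fun_prop
    have hH : DifferentiableAt ℝ (fun y : Fin 4 → ℝ => H (y 1)) x :=
      (hg.hasDerivAt_H hx).differentiableAt.comp x h1
    have hD : DifferentiableAt ℝ (fun y : Fin 4 → ℝ => D (y 1)) x :=
      (hg.hasDerivAt_D hx).differentiableAt.comp x h1
    exact ((((hH.mul_const _).const_add _).add (((hH.pow 2).sub (hD.pow 2)).mul_const _)).sub_const
      _).sub_const _
  rw [e1, pd]
  have hl : HasDerivAt (fun t : ℝ => x + t • (Pi.single c 1 : Fin 4 → ℝ)) (Pi.single c 1) 0 := by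
    simpa using ((hasDerivAt_id (0 : ℝ)).smul_const (Pi.single c 1 : Fin 4 → ℝ)).const_add x
  have h2 := hg.hasDerivAt_ip hl (hasDerivAt_const 0 (Pi.single i 1))
    (hasDerivAt_const 0 (Pi.single j 1)) (by simpa using hx)
  rw [(hasDerivAt_line hd (Pi.single c 1)).unique h2]
  by_cases hc : c = 1
  · subst hc; simp [ip_eq]
  · simp [ip_eq, hc, Pi.single_apply, Ne.symm hc]

/-- Pairing with `ν` lowers the upper index of the Christoffel symbols, so the inverse metric
cancels. Since the metric depends on `r` alone, only the radial components of the three vectors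
survive as coefficients. -/
lemma IsGodelType.ip_christoffel (hg : IsGodelType I H D) {x : Fin 4 → ℝ} (hx : x 1 ∈ I)
    (v w ν : Fin 4 → ℝ) :
    ip H D x (fun k => ∑ a, ∑ b, christoffel (metric H D) x k a b * v a * w b) ν =
      1 / 2 * (v 1 * radialDerivIp H D x w ν + w 1 * radialDerivIp H D x v ν
        - ν 1 * radialDerivIp H D x v w) := by
  have hdet : (metric H D x).det ≠ 0 := by
    rw [metric_det]; exact neg_ne_zero.2 (pow_ne_zero 2 (hg.D_ne_zero _ hx))
  have h1 : ip H D x (fun k => ∑ a, ∑ b, christoffel (metric H D) x k a b * v a * w b) ν =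
      ∑ a, ∑ b, ∑ m, v a * w b * ν m *
        ∑ k, christoffel (metric H D) x k a b * metric H D x k m := by
    simp only [ip, dotProduct, Matrix.mulVec, Fin.sum_univ_four]
    ring
  rw [h1]
  simp only [sum_christoffel_mul _ _ (metric_isSymm H D x) hdet, hg.pd_metric hx]
  simp [Fin.sum_univ_four, radialDerivIp, Pi.single_apply]
  ring

end Godel

/-! ### Partial derivatives -/

section PartialDerivatives

variable {n : ℕ} {E : Type*} [NormedAddCommGroup E] [NormedSpace ℝ E]

lemma contDiffOn_pd {U : Set (Fin n → ℝ)} (hU : IsOpen U) {f : (Fin n → ℝ) → E}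
    (hf : ContDiffOn ℝ ∞ f U) (i : Fin n) : ContDiffOn ℝ ∞ (pd i f) U :=
  (hf.fderiv_of_isOpen hU (m := ∞) (by simp)).clm_apply contDiffOn_const

lemma differentiableAt_of_contDiffOn {U : Set (Fin n → ℝ)} (hU : IsOpen U) {f : (Fin n → ℝ) → E}
    (hf : ContDiffOn ℝ ∞ f U) {u : Fin n → ℝ} (hu : u ∈ U) : DifferentiableAt ℝ f u :=
  (hf.contDiffAt (hU.mem_nhds hu)).differentiableAt (by simp)

lemma pd_apply {ι : Type*} [Fintype ι] {f : (Fin n → ℝ) → ι → ℝ} {u : Fin n → ℝ}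
    (hf : DifferentiableAt ℝ f u) (i : Fin n) (k : ι) :
    pd i (fun y => f y k) u = pd i f u k := by
  rw [pd, pd, (hasFDerivAt_pi'.1 hf.hasFDerivAt k).fderiv]
  rfl

lemma hasDerivAt_pd {f : (Fin n → ℝ) → E} {u : Fin n → ℝ} (hf : DifferentiableAt ℝ f u)
    (i : Fin n) :
    HasDerivAt (fun t : ℝ => f (u + t • (Pi.single i 1 : Fin n → ℝ))) (pd i f u) 0 :=
  hasDerivAt_line hf _

lemma pd_pd_comm {U : Set (Fin n → ℝ)} (hU : IsOpen U) {f : (Fin n → ℝ) → E}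
    (hf : ContDiffOn ℝ ∞ f U) {u : Fin n → ℝ} (hu : u ∈ U) (i j : Fin n) :
    pd i (pd j f) u = pd j (pd i f) u := by
  have hd : DifferentiableAt ℝ (fderiv ℝ f) u :=
    differentiableAt_of_contDiffOn hU (hf.fderiv_of_isOpen hU (m := ∞) (by simp)) hu
  have h : ∀ i j, pd i (pd j f) u = fderiv ℝ (fderiv ℝ f) u (Pi.single i 1) (Pi.single j 1) := by
    intro i j
    unfold pd
    rw [fderiv_clm_apply hd (differentiableAt_const _)]
    simp
  rw [h, h]
  exact (((hf.contDiffAt (hU.mem_nhds hu)).isSymmSndFDerivAt (by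
      rw [minSmoothness_of_isRCLikeNormedField]; exact ENat.LEInfty.out)) _ _)

lemma pd_congr {U : Set (Fin n → ℝ)} (hU : IsOpen U) {f g : (Fin n → ℝ) → E}
    (h : ∀ u ∈ U, f u = g u) {u : Fin n → ℝ} (hu : u ∈ U) (i : Fin n) : pd i f u = pd i g u := by
  have : f =ᶠ[nhds u] g := Filter.eventuallyEq_of_mem (hU.mem_nhds hu) h
  rw [pd, pd, this.fderiv_eq]

lemma fderiv_eq_sum_pd (f : (Fin n → ℝ) → E) (u v : Fin n → ℝ) :
    fderiv ℝ f u v = ∑ k, v k • pd k f u := by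
  conv_lhs => rw [pi_eq_sum_univ' v]
  simp [pd, map_sum]

end PartialDerivatives

/-! ### Smooth families of scalar products -/

section Smooth

variable {n : ℕ} {I : Set ℝ} {H D : ℝ → ℝ} {U : Set (Fin n → ℝ)}
  {X v w : (Fin n → ℝ) → Fin 4 → ℝ}

lemma IsGodelType.contDiffOn_ip (hg : IsGodelType I H D) (hX : ContDiffOn ℝ ∞ X U)
    (hv : ContDiffOn ℝ ∞ v U) (hw : ContDiffOn ℝ ∞ w U) (hI : ∀ u ∈ U, X u ∈ spacetime I) :
    ContDiffOn ℝ ∞ (fun u => ip H D (X u) (v u) (w u)) U := by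
  rw [contDiffOn_pi] at hX hv hw
  have hH : ContDiffOn ℝ ∞ (fun u => H (X u 1)) U := hg.smooth_H.comp (hX 1) hI
  have hD : ContDiffOn ℝ ∞ (fun u => D (X u 1)) U := hg.smooth_D.comp (hX 1) hI
  simp only [ip_eq]
  exact (((((hv 0).mul (hw 0)).add (hH.mul (((hv 0).mul (hw 2)).add ((hv 2).mul (hw 0))))).add
    (((hH.pow 2).sub (hD.pow 2)).mul ((hv 2).mul (hw 2)))).sub ((hv 1).mul (hw 1))).sub
    ((hv 3).mul (hw 3))

lemma IsGodelType.contDiffOn_radialDerivIp (hg : IsGodelType I H D) (hX : ContDiffOn ℝ ∞ X U)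
    (hv : ContDiffOn ℝ ∞ v U) (hw : ContDiffOn ℝ ∞ w U) (hI : ∀ u ∈ U, X u ∈ spacetime I) :
    ContDiffOn ℝ ∞ (fun u => radialDerivIp H D (X u) (v u) (w u)) U := by
  rw [contDiffOn_pi] at hX hv hw
  have hH : ContDiffOn ℝ ∞ (fun u => H (X u 1)) U := hg.smooth_H.comp (hX 1) hI
  have hD : ContDiffOn ℝ ∞ (fun u => D (X u 1)) U := hg.smooth_D.comp (hX 1) hI
  have hH' : ContDiffOn ℝ ∞ (fun u => deriv H (X u 1)) U :=
    (hg.smooth_H.deriv_of_isOpen hg.isOpen (m := ∞) (by simp)).comp (hX 1) hI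
  have hD' : ContDiffOn ℝ ∞ (fun u => deriv D (X u 1)) U :=
    (hg.smooth_D.deriv_of_isOpen hg.isOpen (m := ∞) (by simp)).comp (hX 1) hI
  simp only [radialDerivIp]
  exact (hH'.mul (((hv 0).mul (hw 2)).add ((hv 2).mul (hw 0)))).add
    ((((contDiffOn_const.mul hH).mul hH').sub ((contDiffOn_const.mul hD).mul hD')).mul
      ((hv 2).mul (hw 2)))

lemma IsGodelType.pd_ip (hg : IsGodelType I H D) (hU : IsOpen U) (hX : ContDiffOn ℝ ∞ X U)
    (hv : ContDiffOn ℝ ∞ v U) (hw : ContDiffOn ℝ ∞ w U) (hI : ∀ u ∈ U, X u ∈ spacetime I)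
    {u : Fin n → ℝ} (hu : u ∈ U) (i : Fin n) :
    pd i (fun y => ip H D (X y) (v y) (w y)) u =
      pd i X u 1 * radialDerivIp H D (X u) (v u) (w u) + ip H D (X u) (pd i v u) (w u)
        + ip H D (X u) (v u) (pd i w u) := by
  have h1 := hasDerivAt_pd (differentiableAt_of_contDiffOn hU (hg.contDiffOn_ip hX hv hw hI) hu) i
  have h2 := hg.hasDerivAt_ip (hasDerivAt_pd (differentiableAt_of_contDiffOn hU hX hu) i)
    (hasDerivAt_pd (differentiableAt_of_contDiffOn hU hv hu) i)
    (hasDerivAt_pd (differentiableAt_of_contDiffOn hU hw hu) i) (by simpa [spacetime] using hI u hu)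
  simpa using h1.unique h2

end Smooth

/-! ### Parametrized hypersurfaces -/

/-- `X` is a parametrized nondegenerate hypersurface, on the open set `U` of parameters, with unit
normal field `ν`. -/
structure IsParamHypersurface (I : Set ℝ) (H D : ℝ → ℝ) (ε : ℝ) (U : Set (Fin 3 → ℝ))
    (X ν : (Fin 3 → ℝ) → (Fin 4 → ℝ)) : Prop where
  isOpen : IsOpen U
  smooth : ContDiffOn ℝ ∞ X U
  smooth_normal : ContDiffOn ℝ ∞ ν U
  mem : ∀ u ∈ U, X u ∈ spacetime I
  unit : ∀ u ∈ U, ip H D (X u) (ν u) (ν u) = ε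
  nondegenerate : ∀ u ∈ U, (inducedMetric H D X u).det ≠ 0
  normal : ∀ u ∈ U, ∀ i, ip H D (X u) (pd i X u) (ν u) = 0

/-- The variation of the induced metric in the direction of the vector field `ν` along `X`. -/
noncomputable def firstVar (H D : ℝ → ℝ) (X ν : (Fin 3 → ℝ) → (Fin 4 → ℝ)) (u : Fin 3 → ℝ) :
    Matrix (Fin 3) (Fin 3) ℝ :=
  Matrix.of fun i j => ν u 1 * radialDerivIp H D (X u) (pd i X u) (pd j X u)
    + ip H D (X u) (pd i ν u) (pd j X u) + ip H D (X u) (pd i X u) (pd j ν u)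

lemma inducedMetric_isSymm (H D : ℝ → ℝ) (X : (Fin 3 → ℝ) → (Fin 4 → ℝ)) (u : Fin 3 → ℝ) :
    (inducedMetric H D X u).IsSymm := by
  ext i j
  simp [inducedMetric, ip_comm]

section Param

variable {I : Set ℝ} {H D : ℝ → ℝ} {ε : ℝ} {U : Set (Fin 3 → ℝ)}
  {X ν : (Fin 3 → ℝ) → (Fin 4 → ℝ)}

lemma IsGodelType.secondFF_eq (hg : IsGodelType I H D) (hX : IsParamHypersurface I H D ε U X ν)
    {u : Fin 3 → ℝ} (hu : u ∈ U) (i j : Fin 3) :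
    secondFF H D ε X ν u i j = ε * (ip H D (X u) (pd i (pd j X) u) (ν u)
      + 1 / 2 * (pd i X u 1 * radialDerivIp H D (X u) (pd j X u) (ν u)
        + pd j X u 1 * radialDerivIp H D (X u) (pd i X u) (ν u)
        - ν u 1 * radialDerivIp H D (X u) (pd i X u) (pd j X u))) := by
  rw [← hg.ip_christoffel (hX.mem u hu), ← ip_add_left, secondFF]
  congr 2
  funext k
  rw [ambientCov, pd_apply
    (differentiableAt_of_contDiffOn hX.isOpen (contDiffOn_pd hX.isOpen hX.smooth j) hu)]
  rfl

/-- Differentiating `g(∂ⱼX, ν) = 0` trades the second derivatives of `X` for first derivatives of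
`ν`; the `(i, j)` and `(j, i)` identities are averaged. The resulting form transforms tensorially,
with no second derivatives of a parameter change. -/
lemma IsGodelType.secondFF_eq_firstVar (hg : IsGodelType I H D)
    (hX : IsParamHypersurface I H D ε U X ν) {u : Fin 3 → ℝ} (hu : u ∈ U) (i j : Fin 3) :
    secondFF H D ε X ν u i j = -(ε / 2) * firstVar H D X ν u i j := by
  have key : ∀ i j, 0 = pd i X u 1 * radialDerivIp H D (X u) (pd j X u) (ν u)
      + ip H D (X u) (pd i (pd j X) u) (ν u) + ip H D (X u) (pd j X u) (pd i ν u) := by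
    intro i j
    rw [← hg.pd_ip hX.isOpen hX.smooth (contDiffOn_pd hX.isOpen hX.smooth j) hX.smooth_normal
      hX.mem hu, pd_congr hX.isOpen (g := fun _ => (0 : ℝ)) (fun y hy => hX.normal y hy j) hu]
    simp [pd]
  have h1 := key i j
  have h2 := key j i
  rw [pd_pd_comm hX.isOpen hX.smooth hu j i] at h2
  rw [hg.secondFF_eq hX hu, firstVar, Matrix.of_apply, ip_comm H D (X u) (pd i ν u)]
  linear_combination (-ε / 2) * h1 + (-ε / 2) * h2

lemma IsGodelType.secondFF_comm (hg : IsGodelType I H D)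
    (hX : IsParamHypersurface I H D ε U X ν) {u : Fin 3 → ℝ} (hu : u ∈ U) (i j : Fin 3) :
    secondFF H D ε X ν u i j = secondFF H D ε X ν u j i := by
  rw [hg.secondFF_eq hX hu, hg.secondFF_eq hX hu, pd_pd_comm hX.isOpen hX.smooth hu i j,
    radialDerivIp_comm H D (X u) (pd i X u) (pd j X u)]
  ring

lemma IsGodelType.contDiffOn_secondFF (hg : IsGodelType I H D)
    (hX : IsParamHypersurface I H D ε U X ν) (i j : Fin 3) :
    ContDiffOn ℝ ∞ (fun u => secondFF H D ε X ν u i j) U := by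
  have hp := contDiffOn_pd hX.isOpen hX.smooth
  have hp1 : ∀ i, ContDiffOn ℝ ∞ (fun u => pd i X u 1) U := fun i => contDiffOn_pi.1 (hp i) 1
  have hr : ∀ {v w : (Fin 3 → ℝ) → Fin 4 → ℝ}, ContDiffOn ℝ ∞ v U → ContDiffOn ℝ ∞ w U →
      ContDiffOn ℝ ∞ (fun u => radialDerivIp H D (X u) (v u) (w u)) U :=
    fun hv hw => hg.contDiffOn_radialDerivIp hX.smooth hv hw hX.mem
  refine ContDiffOn.congr ?_ (fun u hu => hg.secondFF_eq hX hu i j)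
  exact contDiffOn_const.mul ((hg.contDiffOn_ip hX.smooth (contDiffOn_pd hX.isOpen (hp j) i)
    hX.smooth_normal hX.mem).add (contDiffOn_const.mul
    ((((hp1 i).mul (hr (hp j) hX.smooth_normal)).add
      ((hp1 j).mul (hr (hp i) hX.smooth_normal))).sub
      ((contDiffOn_pi.1 hX.smooth_normal 1).mul (hr (hp i) (hp j))))))

lemma meanCurv_eq_trace (H D : ℝ → ℝ) (ε : ℝ) (X ν : (Fin 3 → ℝ) → (Fin 4 → ℝ))
    (u : Fin 3 → ℝ) :
    meanCurv H D ε X ν u =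
      ((inducedMetric H D X u)⁻¹ * Matrix.of (secondFF H D ε X ν u)).trace := by
  have hs := (inducedMetric_isSymm H D X u).inv
  rw [meanCurv, Finset.sum_comm, Matrix.trace]
  refine Finset.sum_congr rfl fun j _ => ?_
  rw [Matrix.diag_apply, Matrix.mul_apply]
  refine Finset.sum_congr rfl fun i _ => ?_
  rw [← hs.apply j i]
  rfl

lemma IsGodelType.meanCurv_eq_firstVar (hg : IsGodelType I H D)
    (hX : IsParamHypersurface I H D ε U X ν) {u : Fin 3 → ℝ} (hu : u ∈ U) :
    meanCurv H D ε X ν u =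
      -(ε / 2) * ((inducedMetric H D X u)⁻¹ * firstVar H D X ν u).trace := by
  have : Matrix.of (secondFF H D ε X ν u) = (-(ε / 2)) • firstVar H D X ν u := by
    ext i j
    simpa using hg.secondFF_eq_firstVar hX hu i j
  rw [meanCurv_eq_trace, this, Matrix.mul_smul, Matrix.trace_smul, smul_eq_mul]

/-! ### Change of parameters -/

lemma IsGodelType.meanCurv_reparam (hg : IsGodelType I H D) {U' : Set (Fin 3 → ℝ)}
    {X' ν' : (Fin 3 → ℝ) → (Fin 4 → ℝ)} (hX : IsParamHypersurface I H D ε U X ν)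
    (hX' : IsParamHypersurface I H D ε U' X' ν') {φ : (Fin 3 → ℝ) → (Fin 3 → ℝ)}
    {u : Fin 3 → ℝ} (hu : u ∈ U) (hu' : φ u ∈ U') (hφ : DifferentiableAt ℝ φ u)
    (hXφ : X =ᶠ[nhds u] X' ∘ φ) (hνφ : ν =ᶠ[nhds u] ν' ∘ φ) :
    meanCurv H D ε X ν u = meanCurv H D ε X' ν' (φ u) := by
  set J : Matrix (Fin 3) (Fin 3) ℝ := Matrix.of fun k i => pd i φ u k with hJ
  have hd : ∀ {f f' : (Fin 3 → ℝ) → (Fin 4 → ℝ)}, ContDiffOn ℝ ∞ f' U' →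
      f =ᶠ[nhds u] f' ∘ φ → ∀ i, pd i f u = ∑ k, J k i • pd k f' (φ u) := by
    intro f f' hf' h i
    rw [pd, h.fderiv_eq, fderiv_comp u (differentiableAt_of_contDiffOn hX'.isOpen hf' hu') hφ,
      ContinuousLinearMap.comp_apply, fderiv_eq_sum_pd]
    rfl
  have hXd := hd hX'.smooth hXφ
  have hνd := hd hX'.smooth_normal hνφ
  have hX0 : X u = X' (φ u) := hXφ.self_of_nhds
  have hν0 : ν u = ν' (φ u) := hνφ.self_of_nhds
  have hG : inducedMetric H D X u = Jᵀ * inducedMetric H D X' (φ u) * J := by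
    ext i j
    simp only [inducedMetric, Matrix.of_apply, hXd, hX0, ip_sum_smul_left, ip_sum_smul_right]
    simp only [Matrix.mul_apply, Matrix.transpose_apply, Fin.sum_univ_three, Matrix.of_apply]
    ring
  have hV : firstVar H D X ν u = Jᵀ * firstVar H D X' ν' (φ u) * J := by
    ext i j
    simp only [firstVar, Matrix.of_apply, hXd, hνd, hX0, hν0, ip_sum_smul_left, ip_sum_smul_right,
      radialDerivIp_sum_smul_left, radialDerivIp_sum_smul_right]
    simp only [Matrix.mul_apply, Matrix.transpose_apply, Fin.sum_univ_three, Matrix.of_apply]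
    ring
  have hdet := hX.nondegenerate u hu
  -- Nondegeneracy of the metric in the first parameters makes the Jacobian `J` invertible, so no
  -- inverse of `φ` is needed. Metric and variation change by the same congruence, which leaves the
  -- trace unchanged.
  rw [hG, Matrix.det_mul, Matrix.det_mul, Matrix.det_transpose] at hdet
  have hJu : IsUnit J.det := isUnit_iff_ne_zero.2 (right_ne_zero_of_mul hdet)
  have hJu' : IsUnit Jᵀ.det := by rwa [Matrix.det_transpose]
  rw [hg.meanCurv_eq_firstVar hX hu, hg.meanCurv_eq_firstVar hX' hu', hG, hV]
  congr 1
  rw [Matrix.mul_inv_rev, Matrix.mul_inv_rev]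
  calc (J⁻¹ * ((inducedMetric H D X' (φ u))⁻¹ * Jᵀ⁻¹) *
        (Jᵀ * firstVar H D X' ν' (φ u) * J)).trace
      = (J⁻¹ * ((inducedMetric H D X' (φ u))⁻¹ * (Jᵀ⁻¹ * Jᵀ) *
        firstVar H D X' ν' (φ u) * J)).trace := by simp only [Matrix.mul_assoc]
    _ = ((inducedMetric H D X' (φ u))⁻¹ * firstVar H D X' ν' (φ u)).trace := by
      rw [Matrix.nonsing_inv_mul _ hJu', Matrix.mul_one, Matrix.trace_mul_comm, Matrix.mul_assoc,
        Matrix.mul_nonsing_inv _ hJu, Matrix.mul_one]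

/-! ### Ambient isometries -/

/-- The normal is transported by the differential of `Φ`. The second derivatives of `Φ` that appear
in the variation of the metric cancel by the isometry equation differentiated in the direction `ν`.
-/
lemma IsGodelType.isometry_apply (hg : IsGodelType I H D) {V : Set (Fin 4 → ℝ)}
    {Φ : (Fin 4 → ℝ) → (Fin 4 → ℝ)} (hΦ : IsIsometryOn I H D V Φ)
    (hX : IsParamHypersurface I H D ε U X ν) (hV : ∀ u ∈ U, X u ∈ V) :
    IsParamHypersurface I H D ε U (Φ ∘ X) (fun u => fderiv ℝ Φ (X u) (ν u)) ∧
      ∀ u ∈ U, meanCurv H D ε (Φ ∘ X) (fun u => fderiv ℝ Φ (X u) (ν u)) u =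
        meanCurv H D ε X ν u := by
  have hdΦ : ContDiffOn ℝ ∞ (fderiv ℝ Φ) V := hΦ.smooth.fderiv_of_isOpen hΦ.isOpen (by simp)
  have hΦd : ∀ x ∈ V, DifferentiableAt ℝ Φ x := fun x hx =>
    differentiableAt_of_contDiffOn hΦ.isOpen hΦ.smooth hx
  have hΦdd : ∀ x ∈ V, DifferentiableAt ℝ (fderiv ℝ Φ) x := fun x hx =>
    differentiableAt_of_contDiffOn hΦ.isOpen hdΦ hx
  have hXd : ∀ u ∈ U, DifferentiableAt ℝ X u := fun u hu =>
    differentiableAt_of_contDiffOn hX.isOpen hX.smooth hu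
  have hpd : ∀ u ∈ U, ∀ i, pd i (Φ ∘ X) u = fderiv ℝ Φ (X u) (pd i X u) := by
    intro u hu i
    rw [pd, fderiv_comp u (hΦd _ (hV u hu)) (hXd u hu)]
    rfl
  have hG : ∀ u ∈ U, inducedMetric H D (Φ ∘ X) u = inducedMetric H D X u := by
    intro u hu
    ext i j
    simp only [inducedMetric, Matrix.of_apply, hpd u hu, Function.comp_apply]
    exact hΦ.isometry _ (hV u hu) _ _
  have hΦX : IsParamHypersurface I H D ε U (Φ ∘ X) (fun u => fderiv ℝ Φ (X u) (ν u)) :=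
    { isOpen := hX.isOpen
      smooth := hΦ.smooth.comp hX.smooth hV
      smooth_normal := (hdΦ.comp hX.smooth hV).clm_apply hX.smooth_normal
      mem := fun u hu => hΦ.mapsTo (hV u hu)
      unit := fun u hu => (hΦ.isometry _ (hV u hu) _ _).trans (hX.unit u hu)
      nondegenerate := fun u hu => by rw [hG u hu]; exact hX.nondegenerate u hu
      normal := fun u hu i => by
        rw [hpd u hu]
        exact (hΦ.isometry _ (hV u hu) _ _).trans (hX.normal u hu i) }
  refine ⟨hΦX, fun u hu => ?_⟩
  rw [hg.meanCurv_eq_firstVar hΦX hu, hg.meanCurv_eq_firstVar hX hu, hG u hu]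
  congr 3
  ext i j
  have hνpd : ∀ i, pd i (fun u => fderiv ℝ Φ (X u) (ν u)) u =
      fderiv ℝ (fderiv ℝ Φ) (X u) (pd i X u) (ν u) + fderiv ℝ Φ (X u) (pd i ν u) := by
    intro i
    have h1 : DifferentiableAt ℝ (fun u => fderiv ℝ Φ (X u)) u :=
      (hΦdd _ (hV u hu)).comp u (hXd u hu)
    have h2 : fderiv ℝ (fun u => fderiv ℝ Φ (X u)) u =
        (fderiv ℝ (fderiv ℝ Φ) (X u)).comp (fderiv ℝ X u) :=
      fderiv_comp u (hΦdd _ (hV u hu)) (hXd u hu)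
    rw [pd, fderiv_clm_apply h1 (differentiableAt_of_contDiffOn hX.isOpen hX.smooth_normal hu), h2]
    simp [pd, add_comm]
  have hsymm : ∀ v w, fderiv ℝ (fderiv ℝ Φ) (X u) v w = fderiv ℝ (fderiv ℝ Φ) (X u) w v :=
    ((hΦ.smooth.contDiffAt (hΦ.isOpen.mem_nhds (hV u hu))).isSymmSndFDerivAt (by
      rw [minSmoothness_of_isRCLikeNormedField]; exact ENat.LEInfty.out))
  -- The isometry equation for constant `v`, `w`, differentiated along the line `X u + t • ν u`,
  -- which stays in the open set `V` for small `t`.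
  have hdiff : ∀ v w, fderiv ℝ Φ (X u) (ν u) 1 *
        radialDerivIp H D (Φ (X u)) (fderiv ℝ Φ (X u) v) (fderiv ℝ Φ (X u) w)
      + ip H D (Φ (X u)) (fderiv ℝ (fderiv ℝ Φ) (X u) (ν u) v) (fderiv ℝ Φ (X u) w)
      + ip H D (Φ (X u)) (fderiv ℝ Φ (X u) v) (fderiv ℝ (fderiv ℝ Φ) (X u) (ν u) w) =
      ν u 1 * radialDerivIp H D (X u) v w := by
    intro v w
    have hl : HasDerivAt (fun t : ℝ => X u + t • ν u) (ν u) 0 := by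
      simpa using ((hasDerivAt_id (0 : ℝ)).smul_const (ν u)).const_add (X u)
    have hz : X u + (0 : ℝ) • ν u = X u := by simp
    have hdv : ∀ v, HasDerivAt (fun t : ℝ => fderiv ℝ Φ (X u + t • ν u) v)
        (fderiv ℝ (fderiv ℝ Φ) (X u) (ν u) v) 0 := fun v => by
      simpa using (hasDerivAt_line (hΦdd _ (hV u hu)) (ν u)).clm_apply (hasDerivAt_const 0 v)
    have h1 := hg.hasDerivAt_ip (hasDerivAt_line (hΦd _ (hV u hu)) (ν u)) (hdv v) (hdv w)
      (by rw [hz]; exact hΦ.mapsTo (hV u hu))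
    have h2 := hg.hasDerivAt_ip hl (hasDerivAt_const 0 v) (hasDerivAt_const 0 w)
      (by rw [hz]; exact hX.mem u hu)
    have hev : ∀ᶠ t : ℝ in nhds 0, X u + t • ν u ∈ V :=
      hl.continuousAt.eventually (hΦ.isOpen.mem_nhds (by simpa using hV u hu))
    have h3 := h2.congr_of_eventuallyEq (hev.mono fun t ht => hΦ.isometry _ ht v w)
    have h4 := h1.unique h3
    simpa [ip_eq H D (X u)] using h4
  have hd := hdiff (pd i X u) (pd j X u)
  have hi := hΦ.isometry _ (hV u hu) (pd i ν u) (pd j X u)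
  have hj := hΦ.isometry _ (hV u hu) (pd i X u) (pd j ν u)
  simp only [firstVar, Matrix.of_apply, hpd u hu, hνpd, Function.comp_apply, ip_add_left,
    hsymm _ (ν u), ip_comm H D _ (fderiv ℝ Φ (X u) (pd i X u))] at hd hi hj ⊢
  rw [← hi, ← hj, ← hd]
  ring

end Param

/-! ### Parallel hypersurfaces have constant mean curvature -/

lemma differentiableAt_det_three {E : Type*} [NormedAddCommGroup E] [NormedSpace ℝ E]
    {A : E → Matrix (Fin 3) (Fin 3) ℝ} {x : E}
    (hA : ∀ i j, DifferentiableAt ℝ (fun y => A y i j) x) :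
    DifferentiableAt ℝ (fun y => (A y).det) x := by
  simp only [Matrix.det_fin_three]
  exact (((((((hA 0 0).mul (hA 1 1)).mul (hA 2 2)).sub (((hA 0 0).mul (hA 1 2)).mul (hA 2 1))).sub
    (((hA 0 1).mul (hA 1 0)).mul (hA 2 2))).add (((hA 0 1).mul (hA 1 2)).mul (hA 2 0))).add
    (((hA 0 2).mul (hA 1 0)).mul (hA 2 1))).sub (((hA 0 2).mul (hA 1 1)).mul (hA 2 0))

lemma differentiableAt_inv_three {E : Type*} [NormedAddCommGroup E] [NormedSpace ℝ E]
    {A : E → Matrix (Fin 3) (Fin 3) ℝ} {x : E}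
    (hA : ∀ i j, DifferentiableAt ℝ (fun y => A y i j) x) (h0 : (A x).det ≠ 0) (i j : Fin 3) :
    DifferentiableAt ℝ (fun y => (A y)⁻¹ i j) x := by
  simp only [Matrix.inv_def, Ring.inverse_eq_inv', Matrix.smul_apply, smul_eq_mul,
    Matrix.adjugate_apply]
  refine ((differentiableAt_det_three hA).inv h0).mul (differentiableAt_det_three fun a b => ?_)
  by_cases h : a = j
  · subst h; simp
  · simpa [Matrix.updateRow_ne h] using hA a b

/-- The algebra behind "the trace of a parallel tensor is constant". Here `C` is the connection
matrix in one direction, `K` the inverse metric and primes are derivatives. The connection terms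
cancel by cyclicity of the trace. -/
lemma sum_inv_mul_derivation_eq_zero {n : Type*} [Fintype n] [DecidableEq n]
    {G K S C K' S' : Matrix n n ℝ} (hGK : G * K = 1) (hS : Sᵀ = S)
    (hK' : K' = -(K * (Cᵀ * G + G * C) * K)) (hS' : S' = Cᵀ * S + S * C) :
    ∑ i, ∑ j, (K' i j * S i j + K i j * S' i j) = 0 := by
  have hS't : S'ᵀ = S' := by
    rw [hS', Matrix.transpose_add, Matrix.transpose_mul, Matrix.transpose_mul, hS,
      Matrix.transpose_transpose, add_comm]
  have hKG : K * G = 1 := mul_eq_one_comm.1 hGK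
  have h1 : ∑ i, ∑ j, (K' i j * S i j + K i j * S' i j) = (K' * S).trace + (K * S').trace := by
    conv_rhs => rw [← hS, ← hS't]
    simp only [Finset.sum_add_distrib, Matrix.trace, Matrix.diag_apply, Matrix.mul_apply,
      Matrix.transpose_apply]
  have h2 : K' * S = -(K * Cᵀ * S) - C * K * S := by
    rw [hK']
    calc -(K * (Cᵀ * G + G * C) * K) * S
        = -(K * Cᵀ * (G * K) * S) - (K * G) * C * K * S := by noncomm_ring
      _ = -(K * Cᵀ * S) - C * K * S := by rw [hGK, hKG, Matrix.mul_one, Matrix.one_mul]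
  have h3 : (K * (S * C)).trace = (C * K * S).trace := by
    rw [← Matrix.mul_assoc, Matrix.trace_mul_comm, ← Matrix.mul_assoc]
  rw [h1, h2, hS', Matrix.mul_add, Matrix.trace_add, h3, Matrix.trace_sub, Matrix.trace_neg,
    Matrix.mul_assoc]
  ring

section PartialDerivatives

variable {n : ℕ} {f g : (Fin n → ℝ) → ℝ} {u : Fin n → ℝ}

lemma pd_mul (hf : DifferentiableAt ℝ f u) (hg : DifferentiableAt ℝ g u) (i : Fin n) :
    pd i (fun y => f y * g y) u = pd i f u * g u + f u * pd i g u := by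
  unfold pd
  rw [fderiv_fun_mul hf hg]
  simp
  ring

lemma pd_sum {ι : Type*} (s : Finset ι) {f : ι → (Fin n → ℝ) → ℝ}
    (hf : ∀ a ∈ s, DifferentiableAt ℝ (f a) u) (i : Fin n) :
    pd i (fun y => ∑ a ∈ s, f a y) u = ∑ a ∈ s, pd i (f a) u := by
  unfold pd
  rw [fderiv_fun_sum hf]
  simp

lemma pd_sum_mul {ι : Type*} [Fintype ι] {f g : ι → (Fin n → ℝ) → ℝ}
    (hf : ∀ a, DifferentiableAt ℝ (f a) u) (hg : ∀ a, DifferentiableAt ℝ (g a) u) (i : Fin n) :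
    pd i (fun y => ∑ a, f a y * g a y) u = ∑ a, (pd i (f a) u * g a u + f a u * pd i (g a) u) := by
  rw [pd_sum _ fun a _ => (hf a).fun_mul (hg a)]
  exact Finset.sum_congr rfl fun a _ => pd_mul (hf a) (hg a) i

end PartialDerivatives

section Param

variable {I : Set ℝ} {H D : ℝ → ℝ} {ε : ℝ} {U : Set (Fin 3 → ℝ)}
  {X ν : (Fin 3 → ℝ) → (Fin 4 → ℝ)}

lemma IsGodelType.differentiableAt_inducedMetric (hg : IsGodelType I H D)
    (hX : IsParamHypersurface I H D ε U X ν) {u : Fin 3 → ℝ} (hu : u ∈ U) (i j : Fin 3) :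
    DifferentiableAt ℝ (fun y => inducedMetric H D X y i j) u :=
  differentiableAt_of_contDiffOn hX.isOpen (hg.contDiffOn_ip hX.smooth
    (contDiffOn_pd hX.isOpen hX.smooth i) (contDiffOn_pd hX.isOpen hX.smooth j) hX.mem) hu

lemma IsGodelType.differentiableAt_meanCurv (hg : IsGodelType I H D)
    (hX : IsParamHypersurface I H D ε U X ν) {u : Fin 3 → ℝ} (hu : u ∈ U) :
    DifferentiableAt ℝ (meanCurv H D ε X ν) u := by
  unfold meanCurv
  refine DifferentiableAt.fun_sum fun i _ => DifferentiableAt.fun_sum fun j _ => ?_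
  exact (differentiableAt_inv_three (hg.differentiableAt_inducedMetric hX hu)
    (hX.nondegenerate u hu) i j).mul
    (differentiableAt_of_contDiffOn hX.isOpen (hg.contDiffOn_secondFF hX i j) hu)

lemma IsGodelType.pd_meanCurv_eq_zero (hg : IsGodelType I H D)
    (hX : IsParamHypersurface I H D ε U X ν) {u : Fin 3 → ℝ} (hu : u ∈ U)
    (hpar : ∀ i j k, covSecondFF H D ε X ν u i j k = 0) (k : Fin 3) :
    pd k (meanCurv H D ε X ν) u = 0 := by
  set G := inducedMetric H D X with hG
  have hGd := hg.differentiableAt_inducedMetric hX hu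
  have hKd := differentiableAt_inv_three hGd (hX.nondegenerate u hu)
  have hSd : ∀ i j, DifferentiableAt ℝ (fun y => secondFF H D ε X ν y i j) u := fun i j =>
    differentiableAt_of_contDiffOn hX.isOpen (hg.contDiffOn_secondFF hX i j) hu
  set C : Matrix (Fin 3) (Fin 3) ℝ := Matrix.of fun l i => christoffel G u l k i with hC
  set G' : Matrix (Fin 3) (Fin 3) ℝ := Matrix.of fun i j => pd k (fun y => G y i j) u with hG'
  set K' : Matrix (Fin 3) (Fin 3) ℝ := Matrix.of fun i j => pd k (fun y => (G y)⁻¹ i j) u with hK'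
  set S : Matrix (Fin 3) (Fin 3) ℝ := Matrix.of (secondFF H D ε X ν u) with hS
  set S' : Matrix (Fin 3) (Fin 3) ℝ :=
    Matrix.of fun i j => pd k (fun y => secondFF H D ε X ν y i j) u with hS'
  have hdet : ∀ y ∈ U, IsUnit (G y).det := fun y hy => isUnit_iff_ne_zero.2 (hX.nondegenerate y hy)
  have hsym : ∀ y i j, G y i j = G y j i := fun y i j => (inducedMetric_isSymm H D X y).apply j i
  -- Metric compatibility of the Levi-Civita connection.
  have hGC : G' = Cᵀ * G u + G u * C := by
    ext i j
    have h1 := sum_christoffel_mul G u (inducedMetric_isSymm H D X u) (hX.nondegenerate u hu) k i j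
    have h2 := sum_christoffel_mul G u (inducedMetric_isSymm H D X u) (hX.nondegenerate u hu) k j i
    have h3 : (G u * C) i j = ∑ l, christoffel G u l k j * G u l i := by
      rw [Matrix.mul_apply]
      refine Finset.sum_congr rfl fun l _ => ?_
      rw [hsym u i l, mul_comm]; rfl
    have h4 : (Cᵀ * G u) i j = ∑ l, christoffel G u l k i * G u l j := rfl
    have h5 : (fun y => G y j i) = fun y => G y i j := funext fun y => hsym y j i
    rw [Matrix.add_apply, h3, h4, h1, h2, h5, hG', Matrix.of_apply]
    ring
  -- Obtained by differentiating `G * G⁻¹ = 1` entrywise.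
  have hKK : K' = -((G u)⁻¹ * (Cᵀ * G u + G u * C) * (G u)⁻¹) := by
    have h1 : G' * (G u)⁻¹ + G u * K' = 0 := by
      ext i m
      have h2 : pd k (fun y => ∑ j, G y i j * (G y)⁻¹ j m) u = 0 := by
        rw [pd_congr hX.isOpen (g := fun _ => (1 : Matrix (Fin 3) (Fin 3) ℝ) i m) ?_ hu]
        · simp [pd]
        · intro y hy
          rw [← Matrix.mul_apply, Matrix.mul_nonsing_inv _ (hdet y hy)]
      rw [Matrix.add_apply, Matrix.mul_apply, Matrix.mul_apply, ← Finset.sum_add_distrib]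
      exact (pd_sum_mul (fun j => hGd i j) (fun j => hKd j m) k).symm.trans h2
    rw [← hGC]
    calc K' = (G u)⁻¹ * (G u * K') := by
          rw [← Matrix.mul_assoc, Matrix.nonsing_inv_mul _ (hdet u hu), Matrix.one_mul]
      _ = _ := by rw [eq_neg_of_add_eq_zero_right h1, Matrix.mul_neg, Matrix.mul_assoc]
  have hSS : S' = Cᵀ * S + S * C := by
    ext i j
    have h1 := hpar k i j
    rw [covSecondFF] at h1
    have h3 : (S * C) i j = ∑ l, christoffel G u l k j * secondFF H D ε X ν u i l := by
      rw [Matrix.mul_apply]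
      exact Finset.sum_congr rfl fun l _ => mul_comm _ _
    have h4 : (Cᵀ * S) i j = ∑ l, christoffel G u l k i * secondFF H D ε X ν u l j := rfl
    rw [Matrix.add_apply, h3, h4, hS', Matrix.of_apply]
    linear_combination h1
  have hSt : Sᵀ = S := by
    ext i j
    exact hg.secondFF_comm hX hu j i
  have := sum_inv_mul_derivation_eq_zero (Matrix.mul_nonsing_inv _ (hdet u hu)) hSt hKK hSS
  rw [← this]
  refine (pd_sum _ (fun i _ => DifferentiableAt.fun_sum fun j _ => (hKd i j).mul (hSd i j)) k).trans
    (Finset.sum_congr rfl fun i _ => ?_)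
  exact pd_sum_mul (hKd i) (hSd i) k

end Param

/-! ### Mean curvature on a manifold -/

section Manifold

variable {M : Type*} [TopologicalSpace M] [ChartedSpace (Fin 3 → ℝ) M]
  {I : Set ℝ} {H D : ℝ → ℝ} {ε : ℝ} {F ξ : M → (Fin 4 → ℝ)}

lemma IsHypersurface.isParamHypersurface (hF : IsHypersurface I H D ε F ξ)
    {e : OpenPartialHomeomorph M (Fin 3 → ℝ)}
    (he : e ∈ IsManifold.maximalAtlas 𝓘(ℝ, Fin 3 → ℝ) ∞ M) :
    IsParamHypersurface I H D ε e.target (F ∘ e.symm) (ξ ∘ e.symm) where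
  isOpen := e.open_target
  smooth := contMDiffOn_iff_contDiffOn.1
    (hF.smooth.comp_contMDiffOn (contMDiffOn_symm_of_mem_maximalAtlas he))
  smooth_normal := contMDiffOn_iff_contDiffOn.1
    (hF.smooth_normal.comp_contMDiffOn (contMDiffOn_symm_of_mem_maximalAtlas he))
  mem _ _ := hF.mem _
  unit _ _ := hF.unit _
  nondegenerate := hF.nondegenerate e he
  normal u hu i := hF.normal e he u hu i

lemma IsHypersurface.meanCurv_chart_eq (hg : IsGodelType I H D)
    (hF : IsHypersurface I H D ε F ξ) {e e' : OpenPartialHomeomorph M (Fin 3 → ℝ)}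
    (he : e ∈ IsManifold.maximalAtlas 𝓘(ℝ, Fin 3 → ℝ) ∞ M)
    (he' : e' ∈ IsManifold.maximalAtlas 𝓘(ℝ, Fin 3 → ℝ) ∞ M) {p : M} (hp : p ∈ e.source)
    (hp' : p ∈ e'.source) :
    meanCurv H D ε (F ∘ e.symm) (ξ ∘ e.symm) (e p) =
      meanCurv H D ε (F ∘ e'.symm) (ξ ∘ e'.symm) (e' p) := by
  have hnhds : e.target ∩ e.symm ⁻¹' e'.source ∈ nhds (e p) :=
    (e.isOpen_inter_preimage_symm e'.open_source).mem_nhds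
      ⟨e.map_source hp, by simpa [e.left_inv hp] using hp'⟩
  have hφ : ContDiffOn ℝ ∞ (e' ∘ e.symm) (e.target ∩ e.symm ⁻¹' e'.source) :=
    contMDiffOn_iff_contDiffOn.1 ((contMDiffOn_of_mem_maximalAtlas he').comp
      ((contMDiffOn_symm_of_mem_maximalAtlas he).mono inter_subset_left) inter_subset_right)
  have hev : ∀ f : M → Fin 4 → ℝ, f ∘ e.symm =ᶠ[nhds (e p)] (f ∘ e'.symm) ∘ (e' ∘ e.symm) := by
    intro f
    filter_upwards [hnhds] with u hu
    simp [e'.left_inv hu.2]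
  have hval : (e' ∘ e.symm) (e p) = e' p := by simp [e.left_inv hp]
  rw [← hval]
  exact hg.meanCurv_reparam (hF.isParamHypersurface he) (hF.isParamHypersurface he')
    (e.map_source hp) (by rw [hval]; exact e'.map_source hp')
    ((hφ.contDiffAt hnhds).differentiableAt (by simp)) (hev F) (hev ξ)

lemma IsHypersurface.exists_meanCurv_eq [IsManifold 𝓘(ℝ, Fin 3 → ℝ) ∞ M] [ConnectedSpace M]
    (hg : IsGodelType I H D) (hF : IsHypersurface I H D ε F ξ) (hpar : IsParallel H D ε F ξ) :
    ∃ κ : ℝ, ∀ e ∈ IsManifold.maximalAtlas 𝓘(ℝ, Fin 3 → ℝ) ∞ M, ∀ u ∈ e.target,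
      meanCurv H D ε (F ∘ e.symm) (ξ ∘ e.symm) u = κ := by
  set c : M → OpenPartialHomeomorph M (Fin 3 → ℝ) := fun p => chartAt (Fin 3 → ℝ) p with hc
  have hcm : ∀ p, c p ∈ IsManifold.maximalAtlas 𝓘(ℝ, Fin 3 → ℝ) ∞ M := fun p =>
    IsManifold.chart_mem_maximalAtlas p
  have hcs : ∀ p, p ∈ (c p).source := fun p => mem_chart_source _ p
  -- The mean curvature as a function on `M`, read at each point in the preferred chart there; `hme`
  -- makes the choice of chart irrelevant.
  set m : M → ℝ := fun p => meanCurv H D ε (F ∘ (c p).symm) (ξ ∘ (c p).symm) (c p p) with hm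
  have hme : ∀ e ∈ IsManifold.maximalAtlas 𝓘(ℝ, Fin 3 → ℝ) ∞ M, ∀ p ∈ e.source,
      meanCurv H D ε (F ∘ e.symm) (ξ ∘ e.symm) (e p) = m p := fun e he p hp =>
    hF.meanCurv_chart_eq hg he (hcm p) hp (hcs p)
  have hloc : IsLocallyConstant m := by
    refine (IsLocallyConstant.iff_eventually_eq m).2 fun p => ?_
    have hX := hF.isParamHypersurface (hcm p)
    obtain ⟨δ, hδ, hball⟩ := Metric.isOpen_iff.1 hX.isOpen (c p p) ((c p).map_source (hcs p))
    have hconst : ∀ u ∈ Metric.ball (c p p) δ,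
        meanCurv H D ε (F ∘ (c p).symm) (ξ ∘ (c p).symm) u = m p := by
      intro u hu
      refine Metric.isOpen_ball.is_const_of_fderiv_eq_zero (𝕜 := ℝ)
        (convex_ball _ _).isPreconnected
        (fun y hy => (hg.differentiableAt_meanCurv hX (hball hy)).differentiableWithinAt)
        (fun y hy => ?_) hu (Metric.mem_ball_self hδ)
      ext v
      rw [fderiv_eq_sum_pd]
      simp only [hg.pd_meanCurv_eq_zero hX (hball hy) (hpar _ (hcm p) y (hball hy))]
      simp
    have hcont : ∀ᶠ q in nhds p, c p q ∈ Metric.ball (c p p) δ :=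
      ((c p).continuousAt (hcs p)).eventually (Metric.ball_mem_nhds _ hδ)
    filter_upwards [hcont, (c p).open_source.mem_nhds (hcs p)] with q hq hqs
    rw [← hme _ (hcm p) q hqs]
    exact hconst _ hq
  obtain ⟨p₀⟩ : Nonempty M := inferInstance
  refine ⟨m p₀, fun e he u hu => ?_⟩
  rw [hloc.apply_eq_of_preconnectedSpace p₀ (e.symm u), ← hme e he _ (e.map_target hu),
    e.right_inv hu]

end Manifold

/-! ### Explicit parametrizations -/

/-- Smoothness is known for `X`, so the explicit formula `f` only has to be differentiated along one
coordinate line, component by component. -/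
lemma pd_eq {n : ℕ} {ι : Type*} [Fintype ι] {U : Set (Fin n → ℝ)} (hU : IsOpen U)
    {X f : (Fin n → ℝ) → ι → ℝ} (hX : ContDiffOn ℝ ∞ X U) (h : ∀ y ∈ U, X y = f y)
    {u : Fin n → ℝ} (hu : u ∈ U) (i : Fin n) {v : ι → ℝ}
    (hv : ∀ k, HasDerivAt (fun t : ℝ => f (u + t • (Pi.single i 1 : Fin n → ℝ)) k) (v k) 0) :
    pd i X u = v := by
  have h1 := hasDerivAt_pd (differentiableAt_of_contDiffOn hU hX hu) i
  have hl : Continuous fun t : ℝ => u + t • (Pi.single i 1 : Fin n → ℝ) := by fun_prop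
  have hev : ∀ᶠ t : ℝ in nhds 0, u + t • (Pi.single i 1 : Fin n → ℝ) ∈ U :=
    hl.continuousAt.eventually (hU.mem_nhds (by simpa using hu))
  exact h1.unique ((hasDerivAt_pi.2 hv).congr_of_eventuallyEq (hev.mono fun t ht => h _ ht))

lemma pd_eq_zero {n : ℕ} {E : Type*} [NormedAddCommGroup E] [NormedSpace ℝ E]
    {U : Set (Fin n → ℝ)} (hU : IsOpen U) {f : (Fin n → ℝ) → E} {c : E} (h : ∀ y ∈ U, f y = c)
    {u : Fin n → ℝ} (hu : u ∈ U) (i : Fin n) : pd i f u = 0 := by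
  rw [pd_congr hU (g := fun _ => c) h hu]
  simp [pd]

section Param

variable {I : Set ℝ} {H D : ℝ → ℝ} {ε : ℝ} {U : Set (Fin 3 → ℝ)}
  {X ν : (Fin 3 → ℝ) → (Fin 4 → ℝ)}

lemma IsParamHypersurface.meanCurv_mul_det (hX : IsParamHypersurface I H D ε U X ν)
    {u : Fin 3 → ℝ} (hu : u ∈ U) :
    meanCurv H D ε X ν u * (inducedMetric H D X u).det =
      ((inducedMetric H D X u).adjugate * Matrix.of (secondFF H D ε X ν u)).trace := by
  rw [meanCurv_eq_trace, Matrix.inv_def, Ring.inverse_eq_inv', Matrix.smul_mul, Matrix.trace_smul,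
    smul_eq_mul, mul_comm, mul_inv_cancel_left₀ (hX.nondegenerate u hu)]

/-- In all four families the middle coordinate vector is orthogonal to the other two, so the Gram
matrix splits into a `1 × 1` and a `2 × 2` block. Multiplying by the determinant avoids the inverse
matrix. -/
lemma IsParamHypersurface.meanCurv_mul_of_orthogonal (hX : IsParamHypersurface I H D ε U X ν)
    {u : Fin 3 → ℝ} (hu : u ∈ U) (h01 : ip H D (X u) (pd 0 X u) (pd 1 X u) = 0)
    (h12 : ip H D (X u) (pd 1 X u) (pd 2 X u) = 0) :
    meanCurv H D ε X ν u * (ip H D (X u) (pd 1 X u) (pd 1 X u) *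
      (ip H D (X u) (pd 0 X u) (pd 0 X u) * ip H D (X u) (pd 2 X u) (pd 2 X u)
        - ip H D (X u) (pd 0 X u) (pd 2 X u) ^ 2)) =
      ip H D (X u) (pd 1 X u) (pd 1 X u) *
        (ip H D (X u) (pd 2 X u) (pd 2 X u) * secondFF H D ε X ν u 0 0
          - ip H D (X u) (pd 0 X u) (pd 2 X u) *
            (secondFF H D ε X ν u 0 2 + secondFF H D ε X ν u 2 0)
          + ip H D (X u) (pd 0 X u) (pd 0 X u) * secondFF H D ε X ν u 2 2)
      + (ip H D (X u) (pd 0 X u) (pd 0 X u) * ip H D (X u) (pd 2 X u) (pd 2 X u)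
        - ip H D (X u) (pd 0 X u) (pd 2 X u) ^ 2) * secondFF H D ε X ν u 1 1 := by
  have h := hX.meanCurv_mul_det hu
  have h10 := h01
  have h21 := h12
  rw [ip_comm] at h10 h21
  rw [Matrix.det_fin_three, Matrix.adjugate_fin_three, Matrix.trace_fin_three] at h
  simp only [Matrix.mul_apply, Fin.sum_univ_three, inducedMetric, Matrix.of_apply, h01, h12, h10,
    h21, ip_comm H D (X u) (pd 2 X u) (pd 0 X u)] at h
  simp at h
  linear_combination h

/-! ### The hypersurfaces of constant radius -/

lemma IsGodelType.meanCurv_ne_zero_iff_of_case1 (hg : IsGodelType I H D) (hε : ε ≠ 0)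
    (hX : IsParamHypersurface I H D ε U X ν) {c : ℝ} (hc : Case1 I H D c U X) {u : Fin 3 → ℝ}
    (hu : u ∈ U) : meanCurv H D ε X ν u ≠ 0 ↔ deriv D c ≠ 0 := by
  obtain ⟨hcI, -, hf⟩ := hc
  have hD := hg.D_ne_zero c hcI
  have hU := hX.isOpen
  have hid : ∀ x : ℝ, HasDerivAt (fun t : ℝ => x + t) 1 0 := fun x => (hasDerivAt_id 0).const_add x
  have h0 : ∀ y ∈ U, pd 0 X y = ![1, 0, 0, 0] := fun y hy =>
    pd_eq hU hX.smooth hf hy 0 fun k => by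
      fin_cases k <;> simp [hasDerivAt_const, hid]
  have h1 : ∀ y ∈ U, pd 1 X y = ![-(H c / D c), 0, 1 / D c, 0] := fun y hy =>
    pd_eq hU hX.smooth hf hy 1 fun k => by
      fin_cases k <;> simp [hasDerivAt_const]
      · simpa using ((hid (y 1)).const_mul (H c / D c)).const_sub (y 0)
      · simpa using ((hid (y 1)).const_mul (D c)⁻¹)
  have h2 : ∀ y ∈ U, pd 2 X y = ![0, 0, 0, 1] := fun y hy =>
    pd_eq hU hX.smooth hf hy 2 fun k => by
      fin_cases k <;> simp [hasDerivAt_const, hid]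
  have hr : X u 1 = c := by rw [hf u hu]; rfl
  have n0 := hX.normal u hu 0
  have n1 := hX.normal u hu 1
  have n2 := hX.normal u hu 2
  have hn := hX.unit u hu
  have hm := hX.meanCurv_mul_of_orthogonal hu
  simp only [hg.secondFF_eq hX hu, pd_eq_zero hU h0 hu, pd_eq_zero hU h1 hu, pd_eq_zero hU h2 hu,
    h0 u hu, h1 u hu, h2 u hu, ip_eq, radialDerivIp, hr] at n0 n1 n2 hn hm
  simp at n0 n1 n2 hn hm
  have e1 : D c ^ 2 * ν u 2 = 0 := by
    field_simp at n1
    linear_combination -n1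
  have e2 : ν u 2 = 0 := (mul_eq_zero.1 e1).resolve_left (pow_ne_zero 2 hD)
  have e0 : ν u 0 = 0 := by simpa [e2] using n0
  simp only [e0, e2, n2] at hn
  have hν : ν u 1 ≠ 0 := fun h => hε (by simpa [h] using hn.symm)
  have key : meanCurv H D ε X ν u * D c = -(ε * ν u 1) * deriv D c := by
    -- The remaining premise is the orthogonality of the first two coordinate vectors.
    have h3 := hm (by ring)
    field_simp at h3
    exact mul_left_cancel₀ hD (by linear_combination h3 / 2)
  constructor
  · intro h h'
    rw [h', mul_zero] at key
    exact mul_ne_zero h hD key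
  · intro h h'
    rw [h', zero_mul] at key
    exact mul_ne_zero (neg_ne_zero.2 (mul_ne_zero hε hν)) h key.symm

/-! ### The hypersurfaces over hyperbolas -/

/-- The hypotheses `p' = q`, `q' = p` treat the spacelike and the timelike branch at once. Vanishing
mean curvature and normality give two linear equations for the `t` and `z` components of `ν`, with
determinant `±(p² - q²) ≠ 0`. -/
lemma IsGodelType.meanCurv_ne_zero_of_hyperbola (hg : IsGodelType I H D) (hε : ε ≠ 0)
    (hX : IsParamHypersurface I H D ε U X ν) {a : ℝ} {p q : ℝ → ℝ}
    (hp : ∀ s, HasDerivAt p (q s) s) (hq : ∀ s, HasDerivAt q (p s) s)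
    (hpq : ∀ s, p s ^ 2 ≠ q s ^ 2) (hI : ∀ y ∈ U, y 1 ∈ I) (ha : ∀ y ∈ U, H (y 1) = a)
    (hf : ∀ y ∈ U, X y = ![p (y 0) - a * y 2, y 1, y 2, q (y 0)]) {u : Fin 3 → ℝ} (hu : u ∈ U) :
    meanCurv H D ε X ν u ≠ 0 := by
  have hD := hg.D_ne_zero _ (hI u hu)
  have hU := hX.isOpen
  have hid : ∀ x : ℝ, HasDerivAt (fun t : ℝ => x + t) 1 0 := fun x => (hasDerivAt_id 0).const_add x
  have hcp : ∀ x : ℝ, HasDerivAt (fun t : ℝ => p (x + t)) (q x) 0 := fun x =>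
    HasDerivAt.comp_const_add x 0 (by simpa using hp x)
  have hcq : ∀ x : ℝ, HasDerivAt (fun t : ℝ => q (x + t)) (p x) 0 := fun x =>
    HasDerivAt.comp_const_add x 0 (by simpa using hq x)
  have h0 : ∀ y ∈ U, pd 0 X y = ![q (y 0), 0, 0, p (y 0)] := fun y hy =>
    pd_eq hU hX.smooth hf hy 0 fun k => by
      fin_cases k <;> simp [hasDerivAt_const, hcp, hcq]
  have h1 : ∀ y ∈ U, pd 1 X y = ![0, 1, 0, 0] := fun y hy =>
    pd_eq hU hX.smooth hf hy 1 fun k => by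
      fin_cases k <;> simp [hasDerivAt_const, hid]
  have h2 : ∀ y ∈ U, pd 2 X y = ![-a, 0, 1, 0] := fun y hy =>
    pd_eq hU hX.smooth hf hy 2 fun k => by
      fin_cases k <;> simp [hasDerivAt_const, hid]
      simpa using ((hid (y 2)).const_mul a).const_sub (p (y 0))
  have h00 : pd 0 (pd 0 X) u = ![p (u 0), 0, 0, q (u 0)] :=
    pd_eq hU (contDiffOn_pd hU hX.smooth 0) h0 hu 0 fun k => by
      fin_cases k <;> simp [hasDerivAt_const, hcp, hcq]
  have h20 : pd 2 (pd 0 X) u = 0 :=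
    pd_eq hU (contDiffOn_pd hU hX.smooth 0) h0 hu 2 fun k => by
      fin_cases k <;> simp [hasDerivAt_const]
  -- `H` is known to be constant only at the radii attained; since `U` is open, these fill a
  -- neighbourhood of `u 1`.
  have hH' : deriv H (u 1) = 0 := by
    have hl : Continuous fun t : ℝ => Function.update u 1 t := by fun_prop
    have hev : ∀ᶠ t : ℝ in nhds (u 1), Function.update u 1 t ∈ U :=
      hl.continuousAt.eventually (hU.mem_nhds (by simpa using hu))
    have : H =ᶠ[nhds (u 1)] fun _ => a := hev.mono fun t ht => by simpa using ha _ ht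
    rw [this.deriv_eq, deriv_const]
  have hr : X u 1 = u 1 := by rw [hf u hu]; rfl
  have n0 := hX.normal u hu 0
  have n1 := hX.normal u hu 1
  have n2 := hX.normal u hu 2
  have hn := hX.unit u hu
  have hm := hX.meanCurv_mul_of_orthogonal hu
  simp only [hg.secondFF_eq hX hu, h00, h20, pd_eq_zero hU h1 hu, pd_eq_zero hU h2 hu,
    h0 u hu, h1 u hu, h2 u hu, ip_eq, radialDerivIp, hr, ha u hu, hH'] at n0 n1 n2 hn hm
  simp at n0 n1 n2 hn hm
  have e1 : D (u 1) ^ 2 * ν u 2 = 0 := by linear_combination -n2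
  have e2 : ν u 2 = 0 := (mul_eq_zero.1 e1).resolve_left (pow_ne_zero 2 hD)
  simp only [e2, n1] at n0 hn hm
  intro h
  simp only [h] at hm
  have e3 : D (u 1) ^ 2 * ε * (p (u 0) * ν u 0 - q (u 0) * ν u 3) = 0 := by linear_combination -hm
  have e4 := (mul_eq_zero.1 e3).resolve_left (mul_ne_zero (pow_ne_zero 2 hD) hε)
  have hne := sub_ne_zero.2 (hpq (u 0))
  have e5 : ν u 0 = 0 := (mul_eq_zero.1 (show (p (u 0) ^ 2 - q (u 0) ^ 2) * ν u 0 = 0 by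
    linear_combination p (u 0) * e4 - q (u 0) * n0)).resolve_left hne
  have e6 : ν u 3 = 0 := (mul_eq_zero.1 (show (p (u 0) ^ 2 - q (u 0) ^ 2) * ν u 3 = 0 by
    linear_combination q (u 0) * e4 - p (u 0) * n0)).resolve_left hne
  exact hε (by simpa [e5, e6] using hn.symm)

/-! ### The hypersurfaces over curves of the `(r, φ)`-plane -/

lemma hasDerivAt_integral_of_continuousOn {J : Set ℝ} (hJ : IsOpen J) (hJ' : J.OrdConnected)
    (h0 : (0 : ℝ) ∈ J) {g : ℝ → ℝ} (hgc : ContinuousOn g J) {s : ℝ} (hs : s ∈ J) :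
    HasDerivAt (fun x => ∫ t in (0 : ℝ)..x, g t) (g s) s :=
  intervalIntegral.integral_hasDerivAt_right
    ((hgc.mono (hJ'.uIcc_subset h0 hs)).intervalIntegrable)
    (hgc.stronglyMeasurableAtFilter hJ s hs) (hgc.continuousAt (hJ.mem_nhds hs))

/-- The equivalence is claimed only at a point where `sin θ ≠ 0`: elsewhere both sides of the
condition on `ln |D cos θ|` vanish and `λ` is not determined. -/
lemma IsGodelType.meanCurv_ne_zero_iff_of_case2 (hg : IsGodelType I H D) (hε : ε ≠ 0)
    (hX : IsParamHypersurface I H D ε U X ν) {lam : ℝ} (hc : Case2 I H D lam U X) :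
    ∃ u ∈ U, (meanCurv H D ε X ν u ≠ 0 ↔ lam ≠ 0) := by
  obtain ⟨J, θ, r₀, hJ, hJ', h0J, hθ, hcond, -, hUJ, ⟨u, hu, hsin⟩, -, hf⟩ := hc
  refine ⟨u, hu, ?_⟩
  have hU := hX.isOpen
  have hθd : ∀ s ∈ J, HasDerivAt θ (deriv θ s) s := fun s hs =>
    ((hθ.contDiffAt (hJ.mem_nhds hs)).differentiableAt (by simp)).hasDerivAt
  have hρd : ∀ s ∈ J, HasDerivAt (radial θ r₀) (Real.sin (θ s)) s := fun s hs =>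
    (hasDerivAt_integral_of_continuousOn hJ hJ' h0J
      (Real.continuous_sin.comp_continuousOn hθ.continuousOn) hs).const_add r₀
  have hρI : ∀ s ∈ J, radial θ r₀ s ∈ I := fun s hs => (hcond s hs).1
  set p : ℝ → ℝ := fun s => H (radial θ r₀ s) / D (radial θ r₀ s) * Real.cos (θ s) with hp
  set q : ℝ → ℝ := fun s => Real.cos (θ s) / D (radial θ r₀ s) with hq
  have hHd : ∀ s ∈ J, HasDerivAt (fun s => H (radial θ r₀ s))
      (deriv H (radial θ r₀ s) * Real.sin (θ s)) s := fun s hs =>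
    (hg.hasDerivAt_H (hρI s hs)).comp s (hρd s hs)
  have hDd : ∀ s ∈ J, HasDerivAt (fun s => D (radial θ r₀ s))
      (deriv D (radial θ r₀ s) * Real.sin (θ s)) s := fun s hs =>
    (hg.hasDerivAt_D (hρI s hs)).comp s (hρd s hs)
  have hqd : ∀ s ∈ J, HasDerivAt q ((-Real.sin (θ s) * deriv θ s * D (radial θ r₀ s)
      - Real.cos (θ s) * (deriv D (radial θ r₀ s) * Real.sin (θ s))) / D (radial θ r₀ s) ^ 2) s :=
    fun s hs => (hθd s hs).cos.div (hDd s hs) (hg.D_ne_zero _ (hρI s hs))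
  have hpq : p = fun s => H (radial θ r₀ s) * q s := by
    funext s; simp only [hp, hq]; ring
  have hpd : ∀ s ∈ J, HasDerivAt p (deriv H (radial θ r₀ s) * Real.sin (θ s) * q s
      + H (radial θ r₀ s) * ((-Real.sin (θ s) * deriv θ s * D (radial θ r₀ s)
      - Real.cos (θ s) * (deriv D (radial θ r₀ s) * Real.sin (θ s))) / D (radial θ r₀ s) ^ 2)) s :=
    fun s hs => by rw [hpq]; exact (hHd s hs).mul (hqd s hs)
  have hPd : ∀ s ∈ J, HasDerivAt (fun x => ∫ t in (0 : ℝ)..x, p t) (p s) s := fun s hs =>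
    hasDerivAt_integral_of_continuousOn hJ hJ' h0J
      (fun t ht => (hpd t ht).continuousAt.continuousWithinAt) hs
  have hQd : ∀ s ∈ J, HasDerivAt (fun x => ∫ t in (0 : ℝ)..x, q t) (q s) s := fun s hs =>
    hasDerivAt_integral_of_continuousOn hJ hJ' h0J
      (fun t ht => (hqd t ht).continuousAt.continuousWithinAt) hs
  have hcomp : ∀ {g : ℝ → ℝ} {g' s : ℝ}, HasDerivAt g g' s →
      HasDerivAt (fun t => g (s + t)) g' 0 := fun {g g' s} h =>
    HasDerivAt.comp_const_add s 0 (by simpa using h)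
  have hid : ∀ x : ℝ, HasDerivAt (fun t : ℝ => x + t) 1 0 := fun x => (hasDerivAt_id 0).const_add x
  have h0 : ∀ y ∈ U, pd 0 X y = ![1, 0, 0, 0] := fun y hy =>
    pd_eq hU hX.smooth hf hy 0 fun k => by
      fin_cases k <;> simp [hasDerivAt_const, hid]
  have h1 : ∀ y ∈ U, pd 1 X y = ![p (y 1), Real.sin (θ (y 1)), -q (y 1), 0] := fun y hy =>
    pd_eq hU hX.smooth hf hy 1 fun k => by
      fin_cases k
      · simpa using (hcomp (hPd _ (hUJ y hy))).const_add (y 0)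
      · simpa using hcomp (hρd _ (hUJ y hy))
      · simpa using (hcomp (hQd _ (hUJ y hy))).fun_neg
      · simp [hasDerivAt_const]
  have h2 : ∀ y ∈ U, pd 2 X y = ![0, 0, 0, 1] := fun y hy =>
    pd_eq hU hX.smooth hf hy 2 fun k => by
      fin_cases k <;> simp [hasDerivAt_const, hid]
  have hs := hUJ u hu
  have h11 := pd_eq hU (contDiffOn_pd hU hX.smooth 1) h1 hu 1 (v := ![_, _, _, 0]) fun k => by
      fin_cases k
      · simpa using hcomp (hpd _ hs)
      · simpa using hcomp (hθd _ hs).sin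
      · simpa using (hcomp (hqd _ hs)).fun_neg
      · simp [hasDerivAt_const]
  have hD := hg.D_ne_zero _ (hρI _ hs)
  have hcos := (hcond _ hs).2.1
  have hlog := (hcond _ hs).2.2
  rw [(((hDd _ hs).fun_mul (hθd _ hs).cos).log (mul_ne_zero hD hcos)).deriv, Real.tan_eq_sin_div_cos]
    at hlog
  have hr : X u 1 = radial θ r₀ (u 1) := by rw [hf u hu]; rfl
  have n0 := hX.normal u hu 0
  have n1 := hX.normal u hu 1
  have n2 := hX.normal u hu 2
  have hn := hX.unit u hu
  have hm := hX.meanCurv_mul_of_orthogonal hu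
  simp only [hg.secondFF_eq hX hu, h11, pd_eq_zero hU h0 hu, pd_eq_zero hU h2 hu,
    h0 u hu, h1 u hu, h2 u hu, ip_eq, radialDerivIp, hr, hpq] at n0 n1 n2 hn hm
  simp at n0 n1 n2 hn hm
  have hsc := Real.sin_sq_add_cos_sq (θ (u 1))
  have hqu : q (u 1) * D (radial θ r₀ (u 1)) = Real.cos (θ (u 1)) := by
    simp only [hq]; field_simp
  -- The logarithmic derivative, with the common factor `sin θ / cos θ` cancelled.
  have hkl : D (radial θ r₀ (u 1)) * deriv θ (u 1)
      - deriv D (radial θ r₀ (u 1)) * Real.cos (θ (u 1)) = lam * D (radial θ r₀ (u 1)) := by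
    field_simp at hlog
    linear_combination -hlog
  have hQ : q (u 1) = Real.cos (θ (u 1)) / D (radial θ r₀ (u 1)) := rfl
  clear_value q
  clear hlog h11 hqu hcond hp hpd hPd hqd hq
  generalize Real.sin (θ (u 1)) = σ at *
  generalize Real.cos (θ (u 1)) = γ at *
  generalize deriv θ (u 1) = θ' at *
  generalize radial θ r₀ (u 1) = r at *
  -- Normality makes `(ν¹, D ν²)` proportional to the Euclidean unit vector `(γ, σ) = (cos θ, sin
  -- θ)`; `s` is the scalar product of the two.
  obtain ⟨s, hs1, hs2⟩ : ∃ s, ν u 1 = γ * s ∧ ν u 2 = σ * s / D r := by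
    rw [hQ] at n1
    have n1' : D r * γ * ν u 2 - σ * ν u 1 = 0 := by
      field_simp at n1
      exact (mul_eq_zero.1 (show D r * (D r * γ * ν u 2 - σ * ν u 1) = 0 by
        linear_combination n1)).resolve_left hD
    refine ⟨γ * ν u 1 + σ * (D r * ν u 2), ?_, ?_⟩
    · linear_combination -ν u 1 * hsc - σ * n1'
    · field_simp
      linear_combination -D r * ν u 2 * hsc + γ * n1'
  have hs0 : ν u 0 = -(H r * (σ * s / D r)) := by rw [← hs2]; linear_combination n0
  have hss : s ≠ 0 := by
    rintro rfl
    exact hε (by simpa [hs0, hs1, hs2, n2] using hn.symm)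
  have key : meanCurv H D ε X ν u = ε * s * lam := by
    rw [hs0, hs1, hs2, hQ] at hm
    field_simp at hm
    refine mul_left_cancel₀ (pow_ne_zero 3 hD) ?_
    linear_combination hm / 2 + ε * s * D r ^ 2 * hkl
      + (ε * s * D r ^ 2 * (D r * θ' - deriv D r * γ) - D r ^ 3 * meanCurv H D ε X ν u) * hsc
  rw [key]
  simp [hε, hss]

end Param
/-! ### Ruled hypersurfaces over a moving direction of the `(t, φ)`-plane -/

section Param

variable {I : Set ℝ} {H D : ℝ → ℝ} {ε : ℝ} {U : Set (Fin 3 → ℝ)}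
  {X ν : (Fin 3 → ℝ) → (Fin 4 → ℝ)}

lemma IsParamHypersurface.mono (hX : IsParamHypersurface I H D ε U X ν) {U' : Set (Fin 3 → ℝ)}
    (hU' : IsOpen U') (h : U' ⊆ U) : IsParamHypersurface I H D ε U' X ν where
  isOpen := hU'
  smooth := hX.smooth.mono h
  smooth_normal := hX.smooth_normal.mono h
  mem u hu := hX.mem u (h hu)
  unit u hu := hX.unit u (h hu)
  nondegenerate u hu := hX.nondegenerate u (h hu)
  normal u hu := hX.normal u (h hu)

lemma update_mem_nhds {U : Set (Fin 3 → ℝ)} (hU : IsOpen U) {u : Fin 3 → ℝ} (hu : u ∈ U)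
    (i : Fin 3) : {w : ℝ | Function.update u i w ∈ U} ∈ nhds (u i) := by
  have hl : Continuous fun t : ℝ => Function.update u i t := by fun_prop
  exact hl.continuousAt.preimage_mem_nhds (hU.mem_nhds (by simpa using hu))

/-- Along a line of the ruling the mean curvature is an odd algebraic function of the line
parameter. -/
lemma IsGodelType.meanCurv_ruled (hg : IsGodelType I H D)
    (hX : IsParamHypersurface I H D ε U X ν) {a b : ℝ → ℝ} {W : Set ℝ} (hW : IsOpen W)
    (ha : ContDiffOn ℝ ∞ a W) (hb : ContDiffOn ℝ ∞ b W) (hUW : ∀ y ∈ U, y 0 ∈ W)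
    (hf : ∀ y ∈ U, X y = ![a (y 0) * y 2, y 0, b (y 0) * y 2, y 1]) {r Q : ℝ} (hr : r ∈ I)
    (hQ : Q = (a r + H r * b r) ^ 2 - D r ^ 2 * b r ^ 2) (hQ0 : Q ≠ 0) :
    ∃ c₁ c₂ c₃ c₄ : ℝ, ∀ y ∈ U, y 0 = r → ∃ μ : ℝ,
      meanCurv H D ε X ν y * (c₁ * y 2 ^ 2 - Q) = ε * μ * y 2 * (c₂ + c₃ * y 2 ^ 2) ∧
      μ ^ 2 * (-Q / D r ^ 2 - c₄ * y 2 ^ 2) = ε := by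
  have hD := hg.D_ne_zero r hr
  have hU := hX.isOpen
  have hd : ∀ {f : ℝ → ℝ}, ContDiffOn ℝ ∞ f W → ∀ s ∈ W, HasDerivAt f (deriv f s) s :=
    fun hf s hs => ((hf.contDiffAt (hW.mem_nhds hs)).differentiableAt (by simp)).hasDerivAt
  have ha' := ha.deriv_of_isOpen hW (m := ∞) (by simp)
  have hb' := hb.deriv_of_isOpen hW (m := ∞) (by simp)
  have hcomp : ∀ {g : ℝ → ℝ} {g' s : ℝ}, HasDerivAt g g' s →
      HasDerivAt (fun t => g (s + t)) g' 0 := fun {g g' s} h =>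
    HasDerivAt.comp_const_add s 0 (by simpa using h)
  have hid : ∀ x : ℝ, HasDerivAt (fun t : ℝ => x + t) 1 0 := fun x => (hasDerivAt_id 0).const_add x
  have h0 : ∀ y ∈ U, pd 0 X y = ![deriv a (y 0) * y 2, 1, deriv b (y 0) * y 2, 0] := fun y hy =>
    pd_eq hU hX.smooth hf hy 0 fun k => by
      fin_cases k
      · simpa using (hcomp (hd ha _ (hUW y hy))).mul_const (y 2)
      · simpa using hid (y 0)
      · simpa using (hcomp (hd hb _ (hUW y hy))).mul_const (y 2)
      · simp [hasDerivAt_const]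
  have h1 : ∀ y ∈ U, pd 1 X y = ![0, 0, 0, 1] := fun y hy =>
    pd_eq hU hX.smooth hf hy 1 fun k => by
      fin_cases k <;> simp [hasDerivAt_const, hid]
  have h2 : ∀ y ∈ U, pd 2 X y = ![a (y 0), 0, b (y 0), 0] := fun y hy =>
    pd_eq hU hX.smooth hf hy 2 fun k => by
      fin_cases k
      · simpa using (hid (y 2)).const_mul (a (y 0))
      · simp [hasDerivAt_const]
      · simpa using (hid (y 2)).const_mul (b (y 0))
      · simp [hasDerivAt_const]
  have h00 : ∀ y ∈ U, pd 0 (pd 0 X) y =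
      ![deriv (deriv a) (y 0) * y 2, 0, deriv (deriv b) (y 0) * y 2, 0] := fun y hy =>
    pd_eq hU (contDiffOn_pd hU hX.smooth 0) h0 hy 0 fun k => by
      fin_cases k
      · simpa using (hcomp (hd ha' _ (hUW y hy))).mul_const (y 2)
      · simp [hasDerivAt_const]
      · simpa using (hcomp (hd hb' _ (hUW y hy))).mul_const (y 2)
      · simp [hasDerivAt_const]
  have h02 : ∀ y ∈ U, pd 0 (pd 2 X) y = ![deriv a (y 0), 0, deriv b (y 0), 0] := fun y hy =>
    pd_eq hU (contDiffOn_pd hU hX.smooth 2) h2 hy 0 fun k => by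
      fin_cases k
      · simpa using (hcomp (hd ha _ (hUW y hy)))
      · simp [hasDerivAt_const]
      · simpa using (hcomp (hd hb _ (hUW y hy)))
      · simp [hasDerivAt_const]
  have h22 : ∀ y ∈ U, pd 2 (pd 2 X) y = 0 := fun y hy =>
    pd_eq hU (contDiffOn_pd hU hX.smooth 2) h2 hy 2 fun k => by
      fin_cases k <;> simp [hasDerivAt_const]
  -- The covector `(b, -a)` annihilates the ruling direction `(a, b)` in the `(t, φ)`-plane; `(N₀,
  -- N₂)` is this covector with its index raised.
  obtain ⟨N₀, N₂, hN₀, hN₂, hS⟩ : ∃ N₀ N₂ : ℝ, N₀ + H r * N₂ = b r ∧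
      H r * N₀ + (H r ^ 2 - D r ^ 2) * N₂ = -a r ∧ N₀ * b r - N₂ * a r = -Q / D r ^ 2 := by
    refine ⟨b r - H r * ((H r * b r + a r) / D r ^ 2), (H r * b r + a r) / D r ^ 2, ?_, ?_, ?_⟩
    · ring
    · field_simp; ring
    · rw [hQ]; field_simp; ring
  have hab : a r ^ 2 + b r ^ 2 ≠ 0 := by
    intro h
    have hb0 : b r = 0 := by nlinarith [sq_nonneg (a r), sq_nonneg (b r)]
    have ha0 : a r = 0 := by nlinarith [sq_nonneg (a r), sq_nonneg (b r)]
    exact hQ0 (by rw [hQ, ha0, hb0]; ring)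
  obtain ⟨α, hα⟩ : ∃ α, a r = α := ⟨_, rfl⟩
  obtain ⟨β, hβ⟩ : ∃ β, b r = β := ⟨_, rfl⟩
  obtain ⟨α₁, hα₁⟩ : ∃ α₁, deriv a r = α₁ := ⟨_, rfl⟩
  obtain ⟨β₁, hβ₁⟩ : ∃ β₁, deriv b r = β₁ := ⟨_, rfl⟩
  obtain ⟨α₂, hα₂⟩ : ∃ α₂, deriv (deriv a) r = α₂ := ⟨_, rfl⟩
  obtain ⟨β₂, hβ₂⟩ : ∃ β₂, deriv (deriv b) r = β₂ := ⟨_, rfl⟩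
  obtain ⟨m, hm'⟩ : ∃ m, 2 * H r * deriv H r - 2 * D r * deriv D r = m := ⟨_, rfl⟩
  simp only [hα, hβ] at hQ hN₀ hN₂ hS hab
  -- With `v = (a, b)`: `Q₁ = g(v, v')`, `Q₂ = g(v', v')`, `P = g(v', N)`, `e = g(v'', N)`; the `k`
  -- and `s` are pairings under the radial derivative of the metric, of `v`, `v'` with `N` and among
  -- themselves.
  obtain ⟨Q₁, hQ₁⟩ : ∃ x, x = α * α₁ + H r * (α * β₁ + β * α₁) + (H r ^ 2 - D r ^ 2) * (β * β₁) := ⟨_, rfl⟩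
  obtain ⟨Q₂, hQ₂⟩ : ∃ x, x = α₁ ^ 2 + 2 * H r * (α₁ * β₁) + (H r ^ 2 - D r ^ 2) * β₁ ^ 2 := ⟨_, rfl⟩
  obtain ⟨P, hP⟩ : ∃ x, x = α₁ * (N₀ + H r * N₂) + β₁ * (H r * N₀ + (H r ^ 2 - D r ^ 2) * N₂) := ⟨_, rfl⟩
  obtain ⟨e, he⟩ : ∃ x, x = α₂ * (N₀ + H r * N₂) + β₂ * (H r * N₀ + (H r ^ 2 - D r ^ 2) * N₂) := ⟨_, rfl⟩
  obtain ⟨k₀, hk₀⟩ : ∃ x, x = deriv H r * (α * N₂ + β * N₀) + m * (β * N₂) := ⟨_, rfl⟩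
  obtain ⟨k₁, hk₁⟩ : ∃ x, x = deriv H r * (α₁ * N₂ + β₁ * N₀) + m * (β₁ * N₂) := ⟨_, rfl⟩
  obtain ⟨s₀, hs₀⟩ : ∃ x, x = 2 * deriv H r * (α * β) + m * β ^ 2 := ⟨_, rfl⟩
  obtain ⟨s₁, hs₁⟩ : ∃ x, x = deriv H r * (α * β₁ + β * α₁) + m * (β * β₁) := ⟨_, rfl⟩
  obtain ⟨s₂, hs₂⟩ : ∃ x, x = 2 * deriv H r * (α₁ * β₁) + m * β₁ ^ 2 := ⟨_, rfl⟩
  refine ⟨Q * Q₂ - Q₁ ^ 2, Q * (e + k₁) - 2 * Q₁ * (P + 1 / 2 * k₀) + 1 / 2 * P * s₀,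
    -(1 / 2) * P * (Q * s₂ - 2 * Q₁ * s₁ + Q₂ * s₀), P ^ 2, fun y hy hyr => ?_⟩
  have hr' : X y 1 = r := by rw [hf y hy, ← hyr]; rfl
  have n0 := hX.normal y hy 0
  have n1 := hX.normal y hy 1
  have n2 := hX.normal y hy 2
  have hn := hX.unit y hy
  have hm := hX.meanCurv_mul_of_orthogonal hy
  simp only [hg.secondFF_eq hX hy, pd_pd_comm hU hX.smooth hy 2 0, h00 y hy, h02 y hy, h22 y hy,
    pd_eq_zero hU h1 hy, h0 y hy, h1 y hy, h2 y hy, ip_eq, radialDerivIp, hr', hyr,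
    hα, hβ, hα₁, hβ₁, hα₂, hβ₂, hm']
    at n0 n1 n2 hn hm
  simp at n0 n1 n2 hn hm
  -- The lowered `(t, φ)` part of `ν` annihilates `(α, β)`, hence is a multiple of `(β, -α)`; the
  -- witness is its Euclidean projection coefficient.
  obtain ⟨μ, hμ₀, hμ₂⟩ : ∃ μ, ν y 0 + H r * ν y 2 = β * μ ∧
      H r * ν y 0 + (H r ^ 2 - D r ^ 2) * ν y 2 = -α * μ := by
    refine ⟨(β * (ν y 0 + H r * ν y 2) - α * (H r * ν y 0 + (H r ^ 2 - D r ^ 2) * ν y 2)) /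
      (α ^ 2 + β ^ 2), ?_, ?_⟩
    · field_simp
      linear_combination α * n2
    · field_simp
      linear_combination β * n2
  have hν₂ : ν y 2 = μ * N₂ := by
    refine mul_left_cancel₀ (pow_ne_zero 2 hD) ?_
    linear_combination H r * hμ₀ - hμ₂ - μ * H r * hN₀ + μ * hN₂
  have hν₀ : ν y 0 = μ * N₀ := by
    linear_combination hμ₀ - μ * hN₀ - H r * hν₂
  have hν₁ : ν y 1 = y 2 * μ * P := by
    rw [hP]
    linear_combination -n0 + y 2 * α₁ * hμ₀ + y 2 * β₁ * hμ₂ - y 2 * α₁ * μ * hN₀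
      - y 2 * β₁ * μ * hN₂
  refine ⟨μ, ?_, ?_⟩
  · rw [hν₀, hν₁, hν₂] at hm
    simp only [hQ, hQ₁, hQ₂, he, hk₀, hk₁, hs₀, hs₁, hs₂, hP] at hm ⊢
    linear_combination -hm
  · rw [hν₀, hν₁, hν₂, n1] at hn
    rw [← hS, ← hn]
    linear_combination -μ ^ 2 * N₀ * hN₀ - μ ^ 2 * N₂ * hN₂

open Polynomial in
-- Squaring eliminates the scale `μ` of the normal and leaves a polynomial identity in the line
-- parameter `w`, valid on an open set of `w`, hence identically. At `w = 0` it reads `κ² Q² (-Q /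
-- D²) = 0` with `Q ≠ 0`. Polynomials are needed because `U` may contain no point with `w = 0`.
lemma IsGodelType.meanCurv_eq_zero_of_ruled (hg : IsGodelType I H D)
    (hX : IsParamHypersurface I H D ε U X ν) {a b : ℝ → ℝ} (hU : U.Nonempty)
    (hQ : ∀ y ∈ U, (a (y 0) + H (y 0) * b (y 0)) ^ 2 - D (y 0) ^ 2 * b (y 0) ^ 2 ≠ 0)
    (hf : ∀ y ∈ U, X y = ![a (y 0) * y 2, y 0, b (y 0) * y 2, y 1]) {κ : ℝ}
    (hκ : ∀ y ∈ U, meanCurv H D ε X ν y = κ) : κ = 0 := by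
  obtain ⟨u, hu, hu2⟩ : ∃ u ∈ U, u 2 ≠ 0 := by
    obtain ⟨u, hu⟩ := hU
    obtain ⟨w, hw, hw0⟩ :=
      (infinite_of_mem_nhds _ (update_mem_nhds hX.isOpen hu 2)).exists_notMem_finset {0}
    exact ⟨_, hw, by simpa using hw0⟩
  set W : Set ℝ := {r | Function.update u 0 r ∈ U} with hWdef
  have hlc : ContDiff ℝ ∞ fun r : ℝ => Function.update u 0 r :=
    contDiff_pi.2 fun k => by
      by_cases hk : k = 0
      · subst hk; simp only [Function.update_self]; exact contDiff_id
      · simpa [Function.update_of_ne hk] using contDiff_const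
  have hW : IsOpen W := hX.isOpen.preimage hlc.continuous
  have hXW : ContDiffOn ℝ ∞ (fun r => X (Function.update u 0 r)) W :=
    hX.smooth.comp hlc.contDiffOn fun r hr => hr
  -- Smoothness of `a` and `b` is inherited from `X` on a slice with `u 2 ≠ 0`, so the square root
  -- and logarithm in `θ` need not be differentiated.
  have ha : ContDiffOn ℝ ∞ a W :=
    ((contDiffOn_pi.1 hXW 0).div_const (u 2)).congr fun r hr => by
      rw [hf _ hr]; simp [hu2]
  have hb : ContDiffOn ℝ ∞ b W :=
    ((contDiffOn_pi.1 hXW 2).div_const (u 2)).congr fun r hr => by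
      rw [hf _ hr]; simp [hu2]
  have hU' : IsOpen (U ∩ {y | y 0 ∈ W}) :=
    hX.isOpen.inter (hW.preimage (continuous_apply (0 : Fin 3)))
  have hX' := hX.mono hU' inter_subset_left
  have hu0 : u 0 ∈ W := by simpa [hWdef] using hu
  have hI : u 0 ∈ I := by
    have := hX.mem u hu
    rw [hf u hu] at this
    exact this
  have hD := hg.D_ne_zero _ hI
  obtain ⟨c₁, c₂, c₃, c₄, h⟩ := hg.meanCurv_ruled hX' hW ha hb (fun y hy => hy.2)
    (fun y hy => hf y hy.1) hI rfl (hQ u hu)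
  set Q := (a (u 0) + H (u 0) * b (u 0)) ^ 2 - D (u 0) ^ 2 * b (u 0) ^ 2 with hQdef
  have hpoly : (C κ ^ 2 * (C c₁ * Polynomial.X ^ 2 - C Q) ^ 2 *
      (C (-Q / D (u 0) ^ 2) - C c₄ * Polynomial.X ^ 2) : ℝ[X]) =
      C ε ^ 3 * Polynomial.X ^ 2 * (C c₂ + C c₃ * Polynomial.X ^ 2) ^ 2 := by
    refine Polynomial.eq_of_infinite_eval_eq _ _
      ((infinite_of_mem_nhds _ (update_mem_nhds hX.isOpen hu 2)).mono fun w hw => ?_)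
    obtain ⟨μ, h1, h2⟩ := h _ ⟨hw, by simpa using hu0⟩ (by simp)
    rw [hκ _ hw] at h1
    simp only [Function.update_self] at h1 h2
    simp only [mem_ofPred_eq, eval_mul, eval_pow, eval_sub, eval_add, eval_C, eval_X]
    calc κ ^ 2 * (c₁ * w ^ 2 - Q) ^ 2 * (-Q / D (u 0) ^ 2 - c₄ * w ^ 2)
        = (κ * (c₁ * w ^ 2 - Q)) ^ 2 * (-Q / D (u 0) ^ 2 - c₄ * w ^ 2) := by ring
      _ = ε ^ 2 * w ^ 2 * (c₂ + c₃ * w ^ 2) ^ 2 *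
          (μ ^ 2 * (-Q / D (u 0) ^ 2 - c₄ * w ^ 2)) := by rw [h1]; ring
      _ = ε ^ 3 * w ^ 2 * (c₂ + c₃ * w ^ 2) ^ 2 := by rw [h2]; ring
  have h0 := congrArg (Polynomial.eval 0) hpoly
  simp only [eval_mul, eval_pow, eval_sub, eval_add, eval_C, eval_X] at h0
  have hQ0 : Q ≠ 0 := hQ u hu
  simpa [hQ0, hD] using h0

lemma IsGodelType.meanCurv_eq_zero_of_case3 (hg : IsGodelType I H D)
    (hX : IsParamHypersurface I H D ε U X ν) (hU : U.Nonempty) (hc : Case3 I H D U X) {κ : ℝ}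
    (hκ : ∀ y ∈ U, meanCurv H D ε X ν y = κ) : κ = 0 := by
  obtain ⟨lam, k, σ, -, hcond, hf⟩ := hc
  -- If the factor `r e^{kr}` vanished, so would `∂₂X`, and the induced metric would be degenerate.
  have hτ : ∀ {a b : ℝ → ℝ}, (∀ y ∈ U, X y = ![a (y 0) * (y 0 * Real.exp (k * y 0) * y 2), y 0,
      b (y 0) * (y 0 * Real.exp (k * y 0) * y 2), y 1]) → ∀ y ∈ U, y 0 * Real.exp (k * y 0) ≠ 0 := by
    intro a b hab y hy h0
    have h2 : pd 2 X y = 0 := pd_eq hX.isOpen hX.smooth hab hy 2 fun i => by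
      fin_cases i <;> simp [hasDerivAt_const, h0]
    refine hX.nondegenerate y hy (Matrix.det_eq_zero_of_row_eq_zero 2 fun j => ?_)
    simp [inducedMetric, h2, ip]
  have hmain : ∀ {a b : ℝ → ℝ}, (∀ y ∈ U, (a (y 0) + H (y 0) * b (y 0)) ^ 2
      - D (y 0) ^ 2 * b (y 0) ^ 2 ≠ 0) →
      (∀ y ∈ U, X y = ![a (y 0) * (y 0 * Real.exp (k * y 0) * y 2), y 0,
      b (y 0) * (y 0 * Real.exp (k * y 0) * y 2), y 1]) → κ = 0 := by
    intro a b hne hab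
    refine hg.meanCurv_eq_zero_of_ruled hX (a := fun r => a r * (r * Real.exp (k * r)))
      (b := fun r => b r * (r * Real.exp (k * r))) hU (fun y hy => ?_) (fun y hy => ?_) hκ
    · have := mul_ne_zero (hne y hy) (pow_ne_zero 2 (hτ hab y hy))
      convert this using 1
      ring
    · rw [hab y hy]
      simp only [mul_assoc]
  rcases hf with ⟨-, hf⟩ | ⟨-, hf⟩
  · refine hmain (a := fun r => Real.sinh (case3Theta H D lam σ r)
      - H r / D r * Real.cosh (case3Theta H D lam σ r))
      (b := fun r => Real.cosh (case3Theta H D lam σ r) / D r) (fun y hy => ?_) hf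
    have hD := hg.D_ne_zero _ (hcond y hy).1
    have h1 := Real.cosh_sq (case3Theta H D lam σ (y 0))
    have h2 : (Real.sinh (case3Theta H D lam σ (y 0))
      - H (y 0) / D (y 0) * Real.cosh (case3Theta H D lam σ (y 0))
      + H (y 0) * (Real.cosh (case3Theta H D lam σ (y 0)) / D (y 0))) ^ 2
      - D (y 0) ^ 2 * (Real.cosh (case3Theta H D lam σ (y 0)) / D (y 0)) ^ 2 = -1 := by
      field_simp
      linear_combination -D (y 0) ^ 2 * h1
    simp only [h2]
    norm_num
  · refine hmain (a := fun r => Real.cosh (case3Theta H D lam σ r)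
      - H r / D r * Real.sinh (case3Theta H D lam σ r))
      (b := fun r => Real.sinh (case3Theta H D lam σ r) / D r) (fun y hy => ?_) hf
    have hD := hg.D_ne_zero _ (hcond y hy).1
    have h1 := Real.cosh_sq (case3Theta H D lam σ (y 0))
    have h2 : (Real.cosh (case3Theta H D lam σ (y 0))
      - H (y 0) / D (y 0) * Real.sinh (case3Theta H D lam σ (y 0))
      + H (y 0) * (Real.sinh (case3Theta H D lam σ (y 0)) / D (y 0))) ^ 2
      - D (y 0) ^ 2 * (Real.sinh (case3Theta H D lam σ (y 0)) / D (y 0)) ^ 2 = 1 := by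
      field_simp
      linear_combination D (y 0) ^ 2 * h1
    simp only [h2]
    norm_num

lemma IsGodelType.meanCurv_ne_zero_of_case4 (hg : IsGodelType I H D) (hε : ε ≠ 0)
    (hX : IsParamHypersurface I H D ε U X ν) (hc : Case4 I H D U X) {u : Fin 3 → ℝ}
    (hu : u ∈ U) : meanCurv H D ε X ν u ≠ 0 := by
  obtain ⟨c, hc0, hI, ⟨a, ha⟩, hf⟩ := hc
  have hcc : c ^ 2 ≠ 0 := pow_ne_zero 2 hc0
  have hp : ∀ s, HasDerivAt (fun s => c * Real.cosh s) (c * Real.sinh s) s := fun s =>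
    (Real.hasDerivAt_cosh s).const_mul c
  have hq : ∀ s, HasDerivAt (fun s => c * Real.sinh s) (c * Real.cosh s) s := fun s =>
    (Real.hasDerivAt_sinh s).const_mul c
  rcases hf with ⟨-, hf⟩ | ⟨-, hf⟩
  · exact hg.meanCurv_ne_zero_of_hyperbola hε hX hp hq
      (fun s h => hcc (by linear_combination h - c ^ 2 * Real.cosh_sq s)) hI ha
      (fun y hy => by rw [hf y hy, ha y hy]) hu
  · exact hg.meanCurv_ne_zero_of_hyperbola hε hX hq hp
      (fun s h => hcc (by linear_combination -h - c ^ 2 * Real.cosh_sq s)) hI ha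
      (fun y hy => by rw [hf y hy, ha y hy]) hu

end Param

/-! ### Passing between the hypersurface and its local forms. -/

section Manifold

variable {M : Type*} [TopologicalSpace M] [ChartedSpace (Fin 3 → ℝ) M]
  {I : Set ℝ} {H D : ℝ → ℝ} {ε : ℝ} {F ξ : M → (Fin 4 → ℝ)}

/-- If the mean curvature is the constant `κ`, then so is that of each local form of `F`, with
respect to a suitable unit normal field. -/
lemma LocallyOfForm.exists_normal (hg : IsGodelType I H D) (hF : IsHypersurface I H D ε F ξ)
    {κ : ℝ} (hκ : ∀ e ∈ IsManifold.maximalAtlas 𝓘(ℝ, Fin 3 → ℝ) ∞ M, ∀ u ∈ e.target,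
      meanCurv H D ε (F ∘ e.symm) (ξ ∘ e.symm) u = κ)
    {P : Set (Fin 3 → ℝ) → ((Fin 3 → ℝ) → (Fin 4 → ℝ)) → Prop} (h : LocallyOfForm I H D P F)
    (p : M) : ∃ U X ν, P U X ∧ U.Nonempty ∧ IsParamHypersurface I H D ε U X ν ∧
      ∀ u ∈ U, meanCurv H D ε X ν u = κ := by
  obtain ⟨e, he, hp, V, Φ, hΦ, hV, hP⟩ := h p
  have := hg.isometry_apply hΦ (hF.isParamHypersurface he) hV
  exact ⟨_, _, _, hP, ⟨_, e.map_source hp⟩, this.1, fun u hu => (this.2 u hu).trans (hκ e he u hu)⟩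

/-- If the mean curvature is the constant `κ`, the form of `F` may be refined by a property that
follows from the mean curvature being `κ`. -/
lemma LocallyOfForm.refine (hg : IsGodelType I H D) (hF : IsHypersurface I H D ε F ξ)
    {κ : ℝ} (hκ : ∀ e ∈ IsManifold.maximalAtlas 𝓘(ℝ, Fin 3 → ℝ) ∞ M, ∀ u ∈ e.target,
      meanCurv H D ε (F ∘ e.symm) (ξ ∘ e.symm) u = κ)
    {P P' : Set (Fin 3 → ℝ) → ((Fin 3 → ℝ) → (Fin 4 → ℝ)) → Prop} (h : LocallyOfForm I H D P F)
    (hPP' : ∀ U X ν, P U X → U.Nonempty → IsParamHypersurface I H D ε U X ν →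
      (∀ u ∈ U, meanCurv H D ε X ν u = κ) → P' U X) : LocallyOfForm I H D P' F := by
  intro p
  obtain ⟨e, he, hp, V, Φ, hΦ, hV, hP⟩ := h p
  have := hg.isometry_apply hΦ (hF.isParamHypersurface he) hV
  exact ⟨e, he, hp, V, Φ, hΦ, hV, hPP' _ _ _ hP ⟨_, e.map_source hp⟩ this.1
    fun u hu => (this.2 u hu).trans (hκ e he u hu)⟩

end Manifold

end GodelType

theorem mainTheorem9 {M : Type*} [TopologicalSpace M] [ChartedSpace (Fin 3 → ℝ) M]
    [IsManifold 𝓘(ℝ, Fin 3 → ℝ) ∞ M] [ConnectedSpace M]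
    (I : Set ℝ) (H D : ℝ → ℝ) (hg : GodelType.IsGodelType I H D)
    (ε : ℝ) (F ξ : M → (Fin 4 → ℝ)) (hF : GodelType.IsHypersurface I H D ε F ξ)
    (hpar : GodelType.IsParallel H D ε F ξ)
    (hproper : ¬ GodelType.IsTotallyGeodesic H D ε F ξ)
    (hform :
      GodelType.LocallyOfForm I H D (fun U X => ∃ c, GodelType.Case1 I H D c U X) F ∨
      GodelType.LocallyOfForm I H D (fun U X => ∃ lam, GodelType.Case2 I H D lam U X) F ∨
      GodelType.LocallyOfForm I H D (GodelType.Case3 I H D) F ∨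
      GodelType.LocallyOfForm I H D (GodelType.Case4 I H D) F) :
    GodelType.IsNonzeroCMC H D ε F ξ ↔
      GodelType.LocallyOfForm I H D
        (fun U X => ∃ c, GodelType.Case1 I H D c U X ∧ deriv D c ≠ 0) F ∨
      GodelType.LocallyOfForm I H D
        (fun U X => ∃ lam, GodelType.Case2 I H D lam U X ∧ lam ≠ 0) F ∨
      GodelType.LocallyOfForm I H D (GodelType.Case4 I H D) F := by
  obtain ⟨κ, hκ⟩ := hF.exists_meanCurv_eq hg hpar
  obtain ⟨p₀⟩ : Nonempty M := inferInstance
  have hε : ε ≠ 0 := by rcases hF.sign with h | h <;> simp [h]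
  have hCMC : GodelType.IsNonzeroCMC H D ε F ξ ↔ κ ≠ 0 := by
    refine ⟨fun ⟨κ', hκ', h⟩ => ?_, fun h => ⟨κ, h, hκ⟩⟩
    have he := IsManifold.chart_mem_maximalAtlas (I := 𝓘(ℝ, Fin 3 → ℝ)) (n := ∞) p₀
    rw [← hκ _ he _ (mem_chart_target _ p₀), h _ he _ (mem_chart_target _ p₀)]
    exact hκ'
  rw [hCMC]
  constructor
  · intro hκ0
    rcases hform with h | h | h | h
    · refine Or.inl (h.refine hg hF hκ ?_)
      rintro U X ν ⟨c, hc⟩ ⟨u, hu⟩ hX hm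
      exact ⟨c, hc, (hg.meanCurv_ne_zero_iff_of_case1 hε hX hc hu).1 (by rwa [hm u hu])⟩
    · refine Or.inr (Or.inl (h.refine hg hF hκ ?_))
      rintro U X ν ⟨lam, hc⟩ - hX hm
      obtain ⟨u, hu, hiff⟩ := hg.meanCurv_ne_zero_iff_of_case2 hε hX hc
      exact ⟨lam, hc, hiff.1 (by rwa [hm u hu])⟩
    -- Family 3 has `κ = 0`, so it cannot occur here.
    · obtain ⟨U, X, ν, hc, hU, hX, hm⟩ := h.exists_normal hg hF hκ p₀
      exact absurd (hg.meanCurv_eq_zero_of_case3 hX hU hc hm) hκ0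
    · exact Or.inr (Or.inr h)
  · rintro (h | h | h)
    · obtain ⟨U, X, ν, ⟨c, hc, hD⟩, ⟨u, hu⟩, hX, hm⟩ := h.exists_normal hg hF hκ p₀
      rw [← hm u hu]
      exact (hg.meanCurv_ne_zero_iff_of_case1 hε hX hc hu).2 hD
    · obtain ⟨U, X, ν, ⟨lam, hc, hlam⟩, -, hX, hm⟩ := h.exists_normal hg hF hκ p₀
      obtain ⟨u, hu, hiff⟩ := hg.meanCurv_ne_zero_iff_of_case2 hε hX hc
      rw [← hm u hu]
      exact hiff.2 hlam
    · obtain ⟨U, X, ν, hc, ⟨u, hu⟩, hX, hm⟩ := h.exists_normal hg hF hκ p₀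
      rw [← hm u hu]
      exact hg.meanCurv_ne_zero_of_case4 hε hX hc hu
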